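/- **Conventions.** Let $R$ be an integral domain. A *star operation* on $R$ is a map $X\mapsto X_*$ from the power set of $R$ to itself such that for all $X,Y\subseteq R$ and $c\in R$: (A) $XR\cup\{0\}\subseteq X_*$; (B) $X\subseteq Y_*$ implies $X_*\subseteq Y_*$; (C) $cX_*=(cX)_*$; and such that every *$*$-ideal* (a set $I\subseteq R$ with $I_*=I$) is a ring ideal of $R$. It is *of finite type* if $X_*=\bigcup\{E_*: E\subseteq X\text{ finite}\}$ for all $X\subseteq R$, and *modular* if $(I\cup J)_*\cap N\subseteq (I\cup(J\cap N))_*$ for all $*$-ideals $I,J,N$ with $I\subseteq N$. Let $\mathcal I_*(R)$ be the complete lattice of $*$-ideals, ordered by inclusion, with the multiplication ($*$-product) $(I,J)\mapsto (IJ)_*$, where $IJ=\{ab: a\in I,\,b\in J\}$; its identity is $R$, which is also the empty $*$-product. A $*$-ideal $I$ is *$*$-finitely generated* if $I=E_*$ for a finite $E\subseteq I$; *$*$-invertible* if $(IJ)_*=yR$ for some $J\subseteq R$ and some nonzero $y\in R$; *radical* if $x^n\in I$ with $n\ge 1$ implies $x\in I$; *prime* if $I\ne R$ and $xy\in I$ implies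 $x\in I$ or $y\in I$; *$*$-maximal* if it is maximal among the $*$-ideals different from $R$. The radical of $I$ is $\sqrt I=\{x: x^n\in I\text{ for some }n\ge1\}$. The dimension $\dim_*(R)$ is the supremum of the lengths $n$ of chains $P_0\subsetneq\dots\subsetneq P_n$ of $\ell$-prime elements of $\mathcal I_*(R)$, that is, of $*$-ideals $P\ne R$ such that $(AB)_*\subseteq P$ implies $A\subseteq P$ or $B\subseteq P$ for all $*$-ideals $A,B$. The domain $R$ is a *$*$-SP-domain* if every $*$-ideal is a finite $*$-product of radical $*$-ideals, and a *P$*$MD* if every nonzero $*$-finitely generated $*$-ideal is $*$-invertible. Let $*\text{-}\max^{-1}(R)$ be the set of nonzero $*$-maximal $*$-ideals (these are all the $*$-maximal $*$-ideals unless $R$ is a field) with the inverse topology, which has the sets $\{M: I\subseteq M\}$, $I$ a compact element of the lattice $\mathcal I_*(R)$, as a basis of open sets. For a topological space $X$, let $U(X)$ be the set of compactly supported upper semicontinuous functions $X\to\mathbb N_0$ with pointwise addition and the order $f\le_d g\iff f(x)\ge g(x)$ for all $x$, and let $U_b(X)=U(X)\sqcup\{b\}$ with a new bottom element $b$ such that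 $b+f=f+b=b$ for all $f\in U_b(X)$. **Corollary 8.6.** Let $R$ be an integral domain and $*$ a modular star operation on $R$ of finite type. The following are equivalent. 1. $R$ is a $*$-SP-domain. 2. $\dim_*(R)\le 1$ and every $*$-invertible $*$-ideal of $R$ is a finite $*$-product of radical $*$-ideals of $R$. 3. Each nonzero prime $*$-ideal is $*$-maximal and contains a $*$-invertible radical $*$-ideal. 4. Each $*$-ideal is the $*$-product of finitely many radical $*$-ideals $J_1\subseteq\cdots\subseteq J_n$. Equivalently: (4′) each nonzero $*$-ideal is the $*$-product of a unique finite (possibly empty) sequence $J_1\subseteq\cdots\subseteq J_n$ of radical $*$-ideals different from $R$. 5. The radical of each nonzero $*$-finitely generated $*$-ideal is $*$-invertible. 6. $\mathcal I_*(R)$ is isomorphic to $U_b(*\text{-}\max^{-1}(R))$ as a multiplicative lattice (by an order isomorphism that turns $*$-products into sums). 7. $R$ is a P$*$MD for which the radical of each $*$-finitely generated $*$-ideal is $*$-finitely generated. -/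

import Mathlib

open scoped Pointwise

/-- The set `z(H)` of zero elements of a commutative monoid `H`. -/
def zeroElems (H : Type*) [CommMonoid H] : Set H := {z | ∀ x : H, x * z = z}

/-- A weak ideal system on a commutative monoid `H`: a map `X ↦ X_r = cl X` on the power set with
(A) `XH ∪ z(H) ⊆ X_r`, (B) `X ⊆ Y_r → X_r ⊆ Y_r`, (C) `c X_r ⊆ (cX)_r`. -/
structure WeakIdealSystem (H : Type*) [CommMonoid H] where
  cl : Set H → Set H
  mul_univ_union_subset_cl : ∀ X : Set H, X * Set.univ ∪ zeroElems H ⊆ cl X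
  cl_subset_cl : ∀ X Y : Set H, X ⊆ cl Y → cl X ⊆ cl Y
  smul_cl_subset : ∀ (c : H) (X : Set H), c • cl X ⊆ cl (c • X)

/-- An ideal system: a weak ideal system with `c X_r = (cX)_r`. -/
structure IdealSystem (H : Type*) [CommMonoid H] extends WeakIdealSystem H where
  smul_cl : ∀ (c : H) (X : Set H), c • cl X = cl (c • X)

/-- A star operation on `R`: an ideal system on the multiplicative monoid of `R` all of whose
`r`-ideals are ring ideals of `R`. -/
structure StarOperation (R : Type*) [CommRing R] extends IdealSystem R where
  isIdeal : ∀ I : Set R, cl I = I → ∃ J : Ideal R, (J : Set R) = I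

namespace WeakIdealSystem

variable {H : Type*} [CommMonoid H] (r : WeakIdealSystem H)

/-- `r` is finitary: `X_r` is the union of the `E_r`, `E` a finite subset of `X`. -/
def Finitary : Prop :=
  ∀ X : Set H, r.cl X = ⋃ E ∈ {E : Set H | E ⊆ X ∧ E.Finite}, r.cl E

/-- `I` is an `r`-ideal. -/
def IsRIdeal (I : Set H) : Prop := r.cl I = I

/-- `r` is modular. -/
def Modular : Prop :=
  ∀ I J N : Set H, r.IsRIdeal I → r.IsRIdeal J → r.IsRIdeal N → I ⊆ N →
    r.cl (I ∪ J) ∩ N ⊆ r.cl (I ∪ (J ∩ N))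

/-- A regular element: a cancellative `x` with `(xA)_r = x A_r` for all `A ⊆ H`. -/
def IsRegularElem (x : H) : Prop :=
  (∀ a b : H, x * a = x * b → a = b) ∧ ∀ A : Set H, r.cl (x • A) = x • r.cl A

/-- `I` is an `r`-invertible `r`-ideal: `(IJ)_r = yH` for some `J ⊆ H` and some regular `y`. -/
def IsInvertible (I : Set H) : Prop :=
  r.IsRIdeal I ∧ ∃ (J : Set H) (y : H), r.IsRegularElem y ∧ r.cl (I * J) = y • Set.univ

/-- `I` is an `r`-finitely generated `r`-ideal. -/
def IsFG (I : Set H) : Prop :=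
  r.IsRIdeal I ∧ ∃ E : Set H, E.Finite ∧ E ⊆ I ∧ I = r.cl E

/-- `I` is a prime `r`-ideal. -/
def IsPrimeIdeal (I : Set H) : Prop :=
  r.IsRIdeal I ∧ I ≠ Set.univ ∧ ∀ x y : H, x * y ∈ I → x ∈ I ∨ y ∈ I

/-- `I` is an `r`-maximal `r`-ideal: maximal among the proper `r`-ideals. -/
def IsMaximalIdeal (I : Set H) : Prop :=
  r.IsRIdeal I ∧ I ≠ Set.univ ∧ ∀ J : Set H, r.IsRIdeal J → J ≠ Set.univ → I ⊆ J → J = I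

/-- The radical of a subset of `H`. -/
def rad (I : Set H) : Set H := {x | ∃ n : ℕ, 1 ≤ n ∧ x ^ n ∈ I}

/-- `I` is a radical `r`-ideal. -/
def IsRadicalIdeal (I : Set H) : Prop :=
  r.IsRIdeal I ∧ ∀ (n : ℕ) (x : H), 1 ≤ n → x ^ n ∈ I → x ∈ I

/-- The set `I_r(H)` of `r`-ideals. -/
def RIdeal : Type _ := {I : Set H // r.IsRIdeal I}

variable {r}

theorem subset_cl (X : Set H) : X ⊆ r.cl X := fun x hx =>
  r.mul_univ_union_subset_cl X (Or.inl ⟨x, hx, 1, Set.mem_univ _, mul_one x⟩)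

theorem cl_mono {X Y : Set H} (h : X ⊆ Y) : r.cl X ⊆ r.cl Y :=
  r.cl_subset_cl X Y (h.trans (subset_cl Y))

theorem isRIdeal_cl (X : Set H) : r.IsRIdeal (r.cl X) :=
  Set.Subset.antisymm (r.cl_subset_cl _ _ subset_rfl) (subset_cl _)

theorem cl_cl_mul (X Y : Set H) : r.cl (r.cl X * Y) = r.cl (X * Y) := by
  apply Set.Subset.antisymm
  · apply r.cl_subset_cl
    rintro _ ⟨a, ha, y, hy, rfl⟩
    have h1 : y • a ∈ r.cl (y • X) := r.smul_cl_subset y X ⟨a, ha, rfl⟩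
    have h2 : y • X ⊆ X * Y := by
      rintro _ ⟨x, hx, rfl⟩
      exact ⟨x, hx, y, hy, mul_comm x y⟩
    have h3 := cl_mono h2 h1
    rwa [smul_eq_mul, mul_comm y a] at h3
  · exact cl_mono (Set.mul_subset_mul_right (subset_cl X))

/-- `I_r(H)` is ordered by inclusion. -/
instance : PartialOrder r.RIdeal := PartialOrder.lift Subtype.val Subtype.val_injective

/-- The `r`-closure of a subset, as an `r`-ideal. -/
def toRIdeal (r : WeakIdealSystem H) (X : Set H) : r.RIdeal := ⟨r.cl X, isRIdeal_cl X⟩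

/-- Closure is left adjoint to the inclusion of the `r`-ideals into the power set. -/
def giRIdeal (r : WeakIdealSystem H) :
    GaloisInsertion r.toRIdeal (fun I : r.RIdeal => (I.1 : Set H)) where
  choice X _ := r.toRIdeal X
  gc X I := by
    constructor
    · intro h
      exact (subset_cl X).trans h
    · intro h
      have h2 : r.cl X ⊆ r.cl I.1 := cl_mono h
      rw [show r.cl I.1 = I.1 from I.2] at h2
      exact h2
  le_l_u I := subset_cl I.1
  choice_eq _ _ := rfl

/-- The complete lattice `I_r(H)`: joins are closures of unions and meets are intersections. -/
instance : CompleteLattice r.RIdeal := r.giRIdeal.liftCompleteLattice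

theorem RIdeal.ext' {I J : r.RIdeal} (h : I.1 = J.1) : I = J := Subtype.ext h

/-- The `r`-multiplication `(I, J) ↦ (IJ)_r` on `I_r(H)`; the empty product is `{1}_r = H`. -/
instance : CommMonoid r.RIdeal where
  mul I J := r.toRIdeal (I.1 * J.1)
  one := r.toRIdeal {1}
  mul_comm I J := congrArg r.toRIdeal (mul_comm I.1 J.1)
  mul_assoc I J K := RIdeal.ext' <| by
    change r.cl (r.cl (I.1 * J.1) * K.1) = r.cl (I.1 * r.cl (J.1 * K.1))
    rw [cl_cl_mul, mul_comm I.1 (r.cl _), cl_cl_mul, mul_comm (J.1 * K.1), mul_assoc]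
  one_mul I := RIdeal.ext' <| by
    change r.cl (r.cl {1} * I.1) = I.1
    rw [cl_cl_mul, Set.singleton_one, one_mul]
    exact I.2
  mul_one I := RIdeal.ext' <| by
    change r.cl (I.1 * r.cl {1}) = I.1
    rw [mul_comm, cl_cl_mul, Set.singleton_one, one_mul]
    exact I.2

/-- `ℓ`-prime elements of the multiplicative lattice `I_r(H)`. -/
def IsLPrime (p : r.RIdeal) : Prop :=
  p ≠ 1 ∧ ∀ a b : r.RIdeal, a * b ≤ p → a ≤ p ∨ b ≤ p

/-- `dim_r(H)`: the supremum of the lengths `n` of chains `p_0 < ⋯ < p_n` of `ℓ`-prime elements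
of `I_r(H)`. -/
noncomputable def dim (r : WeakIdealSystem H) : WithBot ℕ∞ :=
  Order.krullDim {p : r.RIdeal // IsLPrime p}

end WeakIdealSystem

/-- The monoid `U(X)` of compactly supported upper semicontinuous functions `X → ℕ`. -/
@[ext] structure CompactUSC (X : Type*) [TopologicalSpace X] where
  toFun : X → ℕ
  usc : UpperSemicontinuous toFun
  cpt : HasCompactSupport toFun

namespace CompactUSC

variable {X : Type*} [TopologicalSpace X]

/-- The order `f ≤_d g ↔ f(x) ≥ g(x)` for all `x`, dual to the pointwise one. -/
instance : PartialOrder (CompactUSC X) where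
  le f g := ∀ x, g.toFun x ≤ f.toFun x
  le_refl f x := le_rfl
  le_trans f g h hfg hgh x := (hgh x).trans (hfg x)
  le_antisymm f g hfg hgf := CompactUSC.ext (funext fun x => le_antisymm (hgf x) (hfg x))

/-- Pointwise addition. -/
instance : Add (CompactUSC X) where
  add f g := ⟨fun x => f.toFun x + g.toFun x, f.usc.add g.usc, f.cpt.add g.cpt⟩

end CompactUSC

/-- `U_b(X)`: the set `U(X)` with a bottom element `b = ⊥` adjoined, `b + f = f + b = b`. -/
abbrev UB (X : Type*) [TopologicalSpace X] : Type _ := WithBot (CompactUSC X)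

namespace StarOperation

variable {R : Type*} [CommRing R] (s : StarOperation R)

/-- The multiplicative lattice `I_*(R)` of `*`-ideals. -/
abbrev StarIdeal : Type _ := s.toWeakIdealSystem.RIdeal

/-- The set `*-max(R)` of nonzero `*`-maximal `*`-ideals. (If the domain `R` is not a field, then
no `*`-maximal `*`-ideal is zero, since each `cR` is a `*`-ideal.) -/
def StarMax : Type _ :=
  {M : s.StarIdeal // s.IsMaximalIdeal M.1 ∧ M.1 ≠ {0}}

/-- The inverse topology on `*-max(R)`: the sets `V(I) = {M | I ⊆ M}`, for `I` a compact element
of `I_*(R)`, are a basis of open sets. -/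
instance : TopologicalSpace s.StarMax :=
  TopologicalSpace.generateFrom
    {V | ∃ I : s.StarIdeal, IsCompactElement I ∧ V = {M : s.StarMax | I ≤ M.1}}

/-- `I` is a finite `*`-product of radical `*`-ideals. -/
def IsProdRadical (I : s.StarIdeal) : Prop :=
  ∃ L : List s.StarIdeal, (∀ J ∈ L, s.IsRadicalIdeal J.1) ∧ L.prod = I

/-- `I = (J_1 ⋯ J_n)_*` for radical `*`-ideals `J_1 ⊆ ⋯ ⊆ J_n`. -/
def IsChainProdRadical (I : s.StarIdeal) (L : List s.StarIdeal) : Prop :=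
  (∀ J ∈ L, s.IsRadicalIdeal J.1) ∧ L.Pairwise (· ≤ ·) ∧ L.prod = I

/-- `R` is a `*`-SP-domain. -/
def IsSPDomain : Prop := ∀ I : s.StarIdeal, s.IsProdRadical I

/-- `R` is a P`*`MD. -/
def IsPMD : Prop := ∀ I : Set R, s.IsFG I → I ≠ {0} → s.IsInvertible I

end StarOperation

/-! The argument is local at prime `*`-ideals P. Localization is carried out inside R by saturation
(`sat`, `loc`), without fractions. An invertible ideal is locally principal
(`exists_local_generator`), and a local generator of a radical ideal is not divisible by the square
of a local nonunit (`not_sq_dvd_of_isRadicalIdeal`).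

The hub is `PrimesMaximalWithRadical`. Under it P is the only nonzero prime inside P, so a local
generator p of an invertible radical J ⊆ P generates the local maximal ideal, and the localization
is a discrete valuation ring (`PrimesMaximalWithRadical.locallyDVR`). A nonzero `*`-ideal I is then
determined by its values `wt I M`, and products become sums. Since J has value 1 at every maximal
ideal containing it, M ↦ `wt I M` is upper semicontinuous; conversely, intersections of maximal
ideals over compact closed sets realize the functions with values at most 1, and products realize
the rest. Radical ideals are those with values at most 1, so splitting f as min(f, 1) + (f - 1)
repeatedly gives the increasing factorization into radicals. Invertibility and finite generation are
also checked locally.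

The hard step is from SP-domains to the hub: a radical local principal ideal pR_P must be all of P
(`IsSPDomain.subset_sat_of_isRadicalIdeal`). If y ∈ P is not in it, the ideal (p, y²) is locally
either radical, which Nakayama's lemma excludes, or inside the square of P. In the second case one
passes to a prime N ⊆ P minimal over a finite set witnessing p ∈ P². There N is locally principal
(`IsSPDomain.exists_top'_eq_locPrincipal`), so p is divisible by a square. Modularity enters only
through Nakayama's lemma.

If radicals of finitely generated ideals are invertible, a strict inclusion P ⊂ M of nonzero primes
again forces a square to divide a local generator of a radical ideal. -/

set_option linter.unusedSectionVars false

namespace WeakIdealSystem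

/-! ### Finitary weak ideal systems: primes, maximal ideals and radicals -/

section Monoid

variable {H : Type*} [CommMonoid H] {r : WeakIdealSystem H}

theorem IsRIdeal.cl_subset {X I : Set H} (hI : r.IsRIdeal I) (h : X ⊆ I) : r.cl X ⊆ I := by
  have h1 := cl_mono (r := r) h
  rwa [show r.cl I = I from hI] at h1

theorem isRIdeal_of_cl_subset {I : Set H} (h : r.cl I ⊆ I) : r.IsRIdeal I :=
  Set.Subset.antisymm h (subset_cl I)

theorem IsRIdeal.mul_mem {I : Set H} (hI : r.IsRIdeal I) (c : H) {x : H} (hx : x ∈ I) :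
    c * x ∈ I := by
  have h := r.mul_univ_union_subset_cl I (Or.inl ⟨x, hx, c, Set.mem_univ _, rfl⟩)
  rw [show r.cl I = I from hI] at h
  rw [mul_comm]
  exact h

theorem mul_mem_cl {X : Set H} (c : H) {x : H} (hx : x ∈ r.cl X) : c * x ∈ r.cl X :=
  (isRIdeal_cl X).mul_mem c hx

theorem mul_mem_cl_smul {X : Set H} (c : H) {x : H} (hx : x ∈ r.cl X) :
    c * x ∈ r.cl (c • X) :=
  r.smul_cl_subset c X ⟨x, hx, rfl⟩

theorem isRIdeal_univ : r.IsRIdeal Set.univ := Set.eq_univ_of_univ_subset (subset_cl _)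

theorem cl_eq_univ_of_one_mem {X : Set H} (h : (1 : H) ∈ r.cl X) : r.cl X = Set.univ :=
  Set.eq_univ_of_forall fun x => by simpa using mul_mem_cl x h

theorem IsRIdeal.one_notMem {I : Set H} (hI : r.IsRIdeal I) (h : I ≠ Set.univ) : (1 : H) ∉ I :=
  fun h1 => h (Set.eq_univ_of_forall fun x => by simpa using hI.mul_mem x h1)

theorem isRIdeal_sInter {S : Set (Set H)} (h : ∀ I ∈ S, r.IsRIdeal I) : r.IsRIdeal (⋂₀ S) :=
  isRIdeal_of_cl_subset <| Set.subset_sInter fun I hI =>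
    (h I hI).cl_subset (Set.sInter_subset_of_mem hI)

theorem cl_mul_cl (X Y : Set H) : r.cl (r.cl X * r.cl Y) = r.cl (X * Y) := by
  rw [cl_cl_mul, mul_comm, cl_cl_mul, mul_comm]

theorem cl_union_cl (X Y : Set H) : r.cl (X ∪ r.cl Y) = r.cl (X ∪ Y) :=
  Set.Subset.antisymm
    (r.cl_subset_cl _ _ (Set.union_subset (Set.subset_union_left.trans (subset_cl _))
      (cl_mono Set.subset_union_right)))
    (cl_mono (Set.union_subset_union_right _ (subset_cl Y)))

theorem Finitary.exists_finite (hr : r.Finitary) {X : Set H} {x : H} (hx : x ∈ r.cl X) :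
    ∃ E : Set H, E ⊆ X ∧ E.Finite ∧ x ∈ r.cl E := by
  rw [hr X] at hx
  simp only [Set.mem_iUnion, Set.mem_ofPred_eq, exists_prop] at hx
  obtain ⟨E, ⟨h1, h2⟩, h3⟩ := hx
  exact ⟨E, h1, h2, h3⟩

theorem Finitary.isRIdeal_sUnion (hr : r.Finitary) {S : Set (Set H)} (hne : S.Nonempty)
    (hd : DirectedOn (· ⊆ ·) S) (h : ∀ I ∈ S, r.IsRIdeal I) : r.IsRIdeal (⋃₀ S) := by
  apply isRIdeal_of_cl_subset
  intro x hx
  obtain ⟨E, hE, hfin, hxE⟩ := hr.exists_finite hx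
  obtain ⟨I, hI, hEI⟩ := DirectedOn.exists_mem_subset_of_finite_of_subset_sUnion hne hd hfin hE
  exact ⟨I, hI, (h I hI).cl_subset hEI hxE⟩

theorem rad_subset_of_subset {I J : Set H} (hJ : r.IsRadicalIdeal J) (h : I ⊆ J) : rad I ⊆ J :=
  fun x ⟨n, hn, hx⟩ => hJ.2 n x hn (h hx)

theorem subset_rad (I : Set H) : I ⊆ rad I := fun x hx => ⟨1, le_rfl, by simpa using hx⟩

theorem IsPrimeIdeal.one_notMem {P : Set H} (hP : r.IsPrimeIdeal P) : (1 : H) ∉ P :=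
  hP.1.one_notMem hP.2.1

theorem IsPrimeIdeal.mul_notMem {P : Set H} (hP : r.IsPrimeIdeal P) {x y : H} (hx : x ∉ P)
    (hy : y ∉ P) : x * y ∉ P := fun h => (hP.2.2 x y h).elim hx hy

theorem IsPrimeIdeal.mem_of_pow_mem {P : Set H} (hP : r.IsPrimeIdeal P) {n : ℕ} {x : H}
    (h : x ^ n ∈ P) : x ∈ P := by
  induction n with
  | zero => exact (hP.one_notMem (by simpa using h)).elim
  | succ n ih =>
    rw [pow_succ] at h
    exact (hP.2.2 _ _ h).elim ih id

theorem IsPrimeIdeal.isRadicalIdeal {P : Set H} (hP : r.IsPrimeIdeal P) : r.IsRadicalIdeal P :=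
  ⟨hP.1, fun _ _ _ h => hP.mem_of_pow_mem h⟩

theorem isRadicalIdeal_univ : r.IsRadicalIdeal Set.univ := ⟨isRIdeal_univ, fun _ _ _ _ => trivial⟩

/-- In a finitary weak ideal system, an `r`-ideal disjoint from a submonoid extends to a prime
`r`-ideal disjoint from it. -/
theorem Finitary.exists_prime_disjoint (hr : r.Finitary) {I : Set H} (hI : r.IsRIdeal I)
    (S : Submonoid H) (hd : Disjoint I S) :
    ∃ P, r.IsPrimeIdeal P ∧ I ⊆ P ∧ Disjoint P (S : Set H) := by
  obtain ⟨P, hIP, hP⟩ := zorn_subset_nonempty {J | r.IsRIdeal J ∧ Disjoint J (S : Set H)} (by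
    intro c hc hchain hne
    exact ⟨⋃₀ c, ⟨hr.isRIdeal_sUnion hne hchain.directedOn fun J hJ => (hc hJ).1,
      Set.disjoint_sUnion_left.2 fun J hJ => (hc hJ).2⟩, fun J hJ => Set.subset_sUnion_of_mem hJ⟩)
    I ⟨hI, hd⟩
  have hPr := hP.prop.1
  have hPd := hP.prop.2
  have key : ∀ x, x ∉ P → ∃ t ∈ S, t ∈ r.cl (P ∪ {x}) := by
    intro x hx
    by_contra! hcon
    have h1 : r.cl (P ∪ {x}) ⊆ P := hP.le_of_ge
      ⟨isRIdeal_cl _, Set.disjoint_right.2 fun t ht => hcon t ht⟩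
      (Set.subset_union_left.trans (subset_cl _))
    exact hx (h1 (subset_cl _ (Or.inr rfl)))
  refine ⟨P, ⟨hPr, ?_, ?_⟩, hIP, hPd⟩
  · rintro rfl
    exact Set.disjoint_left.1 hPd (Set.mem_univ 1) S.one_mem
  · intro x y hxy
    by_contra! hcon
    obtain ⟨t, ht, htx⟩ := key x hcon.1
    obtain ⟨u, hu, huy⟩ := key y hcon.2
    have h1 : t * u ∈ r.cl ((P ∪ {x}) * (P ∪ {y})) := by
      rw [← cl_mul_cl]
      exact subset_cl _ (Set.mul_mem_mul htx huy)
    have h2 : r.cl ((P ∪ {x}) * (P ∪ {y})) ⊆ P := by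
      apply hPr.cl_subset
      rintro _ ⟨a, ha, b, hb, rfl⟩
      rcases ha with ha | rfl
      · simpa only [mul_comm a b] using hPr.mul_mem b ha
      · rcases hb with hb | rfl
        · exact hPr.mul_mem _ hb
        · exact hxy
    exact Set.disjoint_left.1 hPd (h2 h1) (S.mul_mem ht hu)

theorem IsMaximalIdeal.isPrimeIdeal {M : Set H} (hr : r.Finitary) (hM : r.IsMaximalIdeal M) :
    r.IsPrimeIdeal M := by
  obtain ⟨P, hP, hMP, -⟩ := hr.exists_prime_disjoint hM.1 ⊥
    (by simpa using hM.1.one_notMem hM.2.1)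
  rw [← hM.2.2 P hP.1 hP.2.1 hMP]
  exact hP

theorem Finitary.exists_maximal (hr : r.Finitary) {I : Set H} (hI : r.IsRIdeal I)
    (hne : I ≠ Set.univ) : ∃ M, r.IsMaximalIdeal M ∧ I ⊆ M := by
  obtain ⟨M, hIM, hM⟩ := zorn_subset_nonempty {J | r.IsRIdeal J ∧ (1 : H) ∉ J} (by
    intro c hc hchain hne
    exact ⟨⋃₀ c, ⟨hr.isRIdeal_sUnion hne hchain.directedOn fun J hJ => (hc hJ).1,
      fun ⟨J, hJ, h1⟩ => (hc hJ).2 h1⟩, fun J hJ => Set.subset_sUnion_of_mem hJ⟩)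
    I ⟨hI, hI.one_notMem hne⟩
  refine ⟨M, ⟨hM.prop.1, fun h => hM.prop.2 (h ▸ trivial), fun J hJ hJ1 hMJ => ?_⟩, hIM⟩
  exact Set.Subset.antisymm (hM.le_of_ge ⟨hJ, hJ.one_notMem hJ1⟩ hMJ) hMJ

/-- A prime `r`-ideal containing an `r`-ideal `I` contains a minimal prime over `I`. -/
theorem exists_minimal_prime {I P : Set H} (hP : r.IsPrimeIdeal P) (hIP : I ⊆ P) :
    ∃ N, r.IsPrimeIdeal N ∧ I ⊆ N ∧ N ⊆ P ∧
      ∀ Q, r.IsPrimeIdeal Q → I ⊆ Q → Q ⊆ N → Q = N := by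
  obtain ⟨N, hNP, hN⟩ := zorn_superset_nonempty {J | r.IsPrimeIdeal J ∧ I ⊆ J} (by
    intro c hc hchain hne
    refine ⟨⋂₀ c, ⟨⟨isRIdeal_sInter fun J hJ => (hc hJ).1.1, ?_, ?_⟩,
      Set.subset_sInter fun J hJ => (hc hJ).2⟩, fun J hJ => Set.sInter_subset_of_mem hJ⟩
    · obtain ⟨J, hJ⟩ := hne
      exact fun h => (hc hJ).1.one_notMem (Set.mem_sInter.1 (h ▸ Set.mem_univ (1 : H)) J hJ)
    · intro x y hxy
      by_contra! hcon
      simp only [Set.mem_sInter, not_forall] at hcon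
      obtain ⟨⟨J, hJ, hx⟩, K, hK, hy⟩ := hcon
      rcases hchain.total hJ hK with h | h
      · exact ((hc hJ).1.2.2 x y (hxy J hJ)).elim hx fun h' => hy (h h')
      · exact ((hc hK).1.2.2 x y (hxy K hK)).elim (fun h' => hx (h h')) hy)
    P ⟨hP, hIP⟩
  exact ⟨N, hN.prop.1, hN.prop.2, hNP, fun Q hQ hIQ hQN =>
    Set.Subset.antisymm hQN (hN.le_of_le ⟨hQ, hIQ⟩ hQN)⟩

/-! ### The multiplicative lattice of `r`-ideals -/

theorem RIdeal.le_iff {I J : r.RIdeal} : I ≤ J ↔ I.1 ⊆ J.1 := Iff.rfl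

theorem RIdeal.val_mul (I J : r.RIdeal) : (I * J).1 = r.cl (I.1 * J.1) := rfl

theorem RIdeal.val_one : (1 : r.RIdeal).1 = Set.univ :=
  cl_eq_univ_of_one_mem (subset_cl _ rfl)

theorem RIdeal.val_sup (I J : r.RIdeal) : (I ⊔ J).1 = r.cl (I.1 ∪ J.1) := rfl

theorem RIdeal.le_one (I : r.RIdeal) : I ≤ 1 := by
  rw [RIdeal.le_iff, RIdeal.val_one]
  exact Set.subset_univ _

theorem RIdeal.eq_one_iff {I : r.RIdeal} : I = 1 ↔ I.1 = Set.univ :=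
  ⟨fun h => h ▸ RIdeal.val_one, fun h => RIdeal.ext' (h.trans RIdeal.val_one.symm)⟩

theorem RIdeal.mul_mem_mul {I J : r.RIdeal} {x y : H} (hx : x ∈ I.1) (hy : y ∈ J.1) :
    x * y ∈ (I * J).1 := subset_cl _ (Set.mul_mem_mul hx hy)

theorem RIdeal.pow_mem_pow {I : r.RIdeal} {x : H} (hx : x ∈ I.1) (n : ℕ) : x ^ n ∈ (I ^ n).1 := by
  induction n with
  | zero => simp [RIdeal.val_one]
  | succ n ih => simpa [pow_succ] using RIdeal.mul_mem_mul ih hx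

instance : IsOrderedMonoid r.RIdeal where
  mul_le_mul_left I J h K := by
    rw [RIdeal.le_iff, RIdeal.val_mul, RIdeal.val_mul]
    exact cl_mono (Set.mul_subset_mul_right h)

theorem RIdeal.mul_le_left (I J : r.RIdeal) : I * J ≤ I := mul_le_of_le_one_right' J.le_one

theorem RIdeal.mul_le_right (I J : r.RIdeal) : I * J ≤ J := mul_le_of_le_one_left' I.le_one

theorem RIdeal.sup_mul_le (I J K : r.RIdeal) : (I ⊔ J) * K ≤ I * K ⊔ J * K := by
  rw [RIdeal.le_iff, RIdeal.val_mul, RIdeal.val_sup, cl_cl_mul]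
  apply (I * K ⊔ J * K).2.cl_subset
  rw [Set.union_mul]
  exact Set.union_subset
    ((subset_cl _).trans (RIdeal.le_iff.1 (le_sup_left (a := I * K) (b := J * K))))
    ((subset_cl _).trans (RIdeal.le_iff.1 (le_sup_right (a := I * K) (b := J * K))))

theorem RIdeal.prod_le_of_mem {L : List r.RIdeal} {I : r.RIdeal} (h : I ∈ L) : L.prod ≤ I := by
  obtain ⟨K, hK⟩ := List.dvd_prod h
  rw [hK]
  exact I.mul_le_left K

theorem RIdeal.mul_le_prime {P : Set H} (hP : r.IsPrimeIdeal P) {I J : r.RIdeal}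
    (h : (I * J).1 ⊆ P) : I.1 ⊆ P ∨ J.1 ⊆ P := by
  by_contra! hcon
  obtain ⟨x, hx, hxP⟩ := Set.not_subset.1 hcon.1
  obtain ⟨y, hy, hyP⟩ := Set.not_subset.1 hcon.2
  exact hP.mul_notMem hxP hyP (h (RIdeal.mul_mem_mul hx hy))

theorem RIdeal.exists_mem_le_prime {P : Set H} (hP : r.IsPrimeIdeal P) {L : List r.RIdeal}
    (h : L.prod.1 ⊆ P) : ∃ I ∈ L, I.1 ⊆ P := by
  induction L with
  | nil => exact (hP.one_notMem (h (by simp [RIdeal.val_one]))).elim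
  | cons J L ih =>
    rw [List.prod_cons] at h
    rcases RIdeal.mul_le_prime hP h with h | h
    · exact ⟨J, by simp, h⟩
    · obtain ⟨I, hI, hIP⟩ := ih h
      exact ⟨I, by simp [hI], hIP⟩

theorem isLPrime_iff {p : r.RIdeal} : IsLPrime p ↔ r.IsPrimeIdeal p.1 := by
  constructor
  · rintro ⟨h1, h2⟩
    refine ⟨p.2, fun h => h1 (RIdeal.eq_one_iff.2 h), fun x y hxy => ?_⟩
    have h3 : r.toRIdeal {x} * r.toRIdeal {y} ≤ p := by
      rw [RIdeal.le_iff, RIdeal.val_mul]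
      change r.cl (r.cl {x} * r.cl {y}) ⊆ p.1
      rw [cl_mul_cl, Set.singleton_mul_singleton]
      exact p.2.cl_subset (by simpa using hxy)
    exact (h2 _ _ h3).imp (fun h => h (subset_cl _ rfl)) (fun h => h (subset_cl _ rfl))
  · rintro hp
    exact ⟨fun h => hp.2.1 (RIdeal.eq_one_iff.1 h), fun a b hab => RIdeal.mul_le_prime hp hab⟩

/-- An ideal is the directed join of the closures of its finite subsets. Conversely, directed unions
of ideals are ideals by finitarity, so a finite set below a directed join lies in one member. -/
theorem Finitary.isCompactElement_iff (hr : r.Finitary) {K : r.RIdeal} :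
    IsCompactElement K ↔ ∃ E : Set H, E.Finite ∧ K = r.toRIdeal E := by
  constructor
  · intro hK
    obtain ⟨_, ⟨E, ⟨hEK, hE⟩, rfl⟩, h⟩ := hK (r.toRIdeal '' {E | E ⊆ K.1 ∧ E.Finite}) K
      ⟨_, ∅, ⟨Set.empty_subset _, Set.finite_empty⟩, rfl⟩ (by
        rintro _ ⟨E, hE, rfl⟩ _ ⟨F, hF, rfl⟩
        exact ⟨_, ⟨E ∪ F, ⟨Set.union_subset hE.1 hF.1, hE.2.union hF.2⟩, rfl⟩,
          cl_mono Set.subset_union_left, cl_mono Set.subset_union_right⟩) (by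
        constructor
        · rintro _ ⟨E, hE, rfl⟩
          exact K.2.cl_subset hE.1
        · intro J hJ x hx
          exact hJ ⟨{x}, ⟨by simpa using hx, Set.finite_singleton x⟩, rfl⟩ (subset_cl _ rfl)) le_rfl
    exact ⟨E, hE, le_antisymm h (K.2.cl_subset hEK)⟩
  · rintro ⟨E, hE, rfl⟩ S u hne hd hu hle
    have hun : r.IsRIdeal (⋃₀ (Subtype.val '' S)) := by
      refine hr.isRIdeal_sUnion (hne.image _) ?_ ?_
      · rintro _ ⟨I, hI, rfl⟩ _ ⟨J, hJ, rfl⟩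
        obtain ⟨K, hK, h1, h2⟩ := hd I hI J hJ
        exact ⟨K.1, ⟨K, hK, rfl⟩, h1, h2⟩
      · rintro _ ⟨I, -, rfl⟩
        exact I.2
    have hu' : u ≤ ⟨_, hun⟩ := hu.2 fun I hI => Set.subset_sUnion_of_mem ⟨I, hI, rfl⟩
    obtain ⟨_, ⟨I, hI, rfl⟩, hEI⟩ := DirectedOn.exists_mem_subset_of_finite_of_subset_sUnion
      (c := Subtype.val '' S) (hne.image _) (by
        rintro _ ⟨I, hI, rfl⟩ _ ⟨J, hJ, rfl⟩
        obtain ⟨K, hK, h1, h2⟩ := hd I hI J hJ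
        exact ⟨K.1, ⟨K, hK, rfl⟩, h1, h2⟩) hE ((subset_cl E).trans (hle.trans hu'))
    exact ⟨I, hI, I.2.cl_subset hEI⟩

end Monoid

/-! ### Localization at a prime by saturation -/

section Saturation

variable {H : Type*} [CommMonoid H] {r : WeakIdealSystem H}

theorem isRIdeal_colon {I : Set H} (hI : r.IsRIdeal I) (x : H) : r.IsRIdeal {y | x * y ∈ I} := by
  apply isRIdeal_of_cl_subset
  intro y hy
  have h := mul_mem_cl_smul x hy
  refine hI.cl_subset ?_ h
  rintro _ ⟨z, hz, rfl⟩
  exact hz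

/-- The radical is the intersection of the primes over `I`: if no power of `x` lies in `I`, some
prime over `I` avoids the powers of `x`. -/
theorem Finitary.isRadicalIdeal_rad (hr : r.Finitary) {I : Set H} (hI : r.IsRIdeal I) :
    r.IsRadicalIdeal (rad I) := by
  have h : rad I = ⋂₀ {P | r.IsPrimeIdeal P ∧ I ⊆ P} := by
    apply Set.Subset.antisymm
    · exact Set.subset_sInter fun P hP => rad_subset_of_subset hP.1.isRadicalIdeal hP.2
    · intro x hx
      by_contra hcon
      have hd : Disjoint I (Submonoid.powers x : Set H) := by
        rw [Set.disjoint_right]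
        rintro _ ⟨n, rfl⟩ hn
        refine hcon ⟨n + 1, by omega, ?_⟩
        rw [pow_succ']
        exact hI.mul_mem x hn
      obtain ⟨P, hP, hIP, hdP⟩ := hr.exists_prime_disjoint hI _ hd
      exact Set.disjoint_left.1 hdP (hx P ⟨hP, hIP⟩) (Submonoid.mem_powers x)
  refine ⟨h ▸ isRIdeal_sInter fun P hP => hP.1.1, ?_⟩
  rintro n x hn ⟨m, hm, hx⟩
  exact ⟨n * m, Nat.mul_pos hn hm, by rwa [pow_mul]⟩

/-- The saturation of `I` with respect to the complement of `P`. -/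
def sat (P I : Set H) : Set H := {x | ∃ t, t ∉ P ∧ t * x ∈ I}

theorem sat_mono (P : Set H) {I J : Set H} (h : I ⊆ J) : sat P I ⊆ sat P J :=
  fun _ ⟨t, ht, htx⟩ => ⟨t, ht, h htx⟩

namespace IsPrimeIdeal

variable {P : Set H}

theorem subset_sat (hP : r.IsPrimeIdeal P) (I : Set H) : I ⊆ sat P I := fun x hx =>
  ⟨1, hP.one_notMem, by simpa using hx⟩

theorem sat_sat (hP : r.IsPrimeIdeal P) (I : Set H) : sat P (sat P I) ⊆ sat P I := by
  rintro x ⟨t, ht, u, hu, h⟩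
  exact ⟨u * t, hP.mul_notMem hu ht, by rwa [mul_assoc]⟩

theorem sat_subset (hP : r.IsPrimeIdeal P) {I : Set H} (h : I ⊆ P) : sat P I ⊆ P := by
  rintro x ⟨t, ht, hx⟩
  exact (hP.2.2 _ _ (h hx)).resolve_left ht

/-- Denominators of finitely many elements multiply to a common one outside `P`. This turns local
statements about finite sets into global ones. -/
theorem exists_common (hP : r.IsPrimeIdeal P) {I F : Set H} (hI : r.IsRIdeal I) (hF : F.Finite)
    (h : F ⊆ sat P I) : ∃ t, t ∉ P ∧ ∀ f ∈ F, t * f ∈ I := by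
  induction F, hF using Set.Finite.induction_on with
  | empty => exact ⟨1, hP.one_notMem, by simp⟩
  | @insert a F _ _ ih =>
    obtain ⟨t, ht, h1⟩ := ih ((Set.subset_insert _ _).trans h)
    obtain ⟨u, hu, h2⟩ := h (Set.mem_insert a F)
    refine ⟨t * u, hP.mul_notMem ht hu, ?_⟩
    rintro f (rfl | hf)
    · rw [mul_assoc]
      exact hI.mul_mem t h2
    · rw [mul_comm t u, mul_assoc]
      exact hI.mul_mem u (h1 f hf)

theorem isRIdeal_sat (hP : r.IsPrimeIdeal P) (hr : r.Finitary) {I : Set H} (hI : r.IsRIdeal I) :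
    r.IsRIdeal (sat P I) := by
  apply isRIdeal_of_cl_subset
  intro x hx
  obtain ⟨F, hFs, hF, hxF⟩ := hr.exists_finite hx
  obtain ⟨t, ht, h⟩ := hP.exists_common hI hF hFs
  refine ⟨t, ht, hI.cl_subset ?_ (mul_mem_cl_smul t hxF)⟩
  rintro _ ⟨f, hf, rfl⟩
  exact h f hf

theorem isRadicalIdeal_sat (hP : r.IsPrimeIdeal P) (hr : r.Finitary) {I : Set H}
    (hI : r.IsRadicalIdeal I) : r.IsRadicalIdeal (sat P I) := by
  refine ⟨hP.isRIdeal_sat hr hI.1, ?_⟩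
  rintro n x hn ⟨t, ht, h⟩
  refine ⟨t, ht, hI.2 n _ hn ?_⟩
  rw [mul_pow, ← Nat.sub_add_cancel hn, pow_succ t, mul_assoc]
  exact hI.1.mul_mem _ (by rwa [Nat.sub_add_cancel hn])

/-- The localization of a finitary weak ideal system at a prime `r`-ideal `P`. -/
def loc (hP : r.IsPrimeIdeal P) (hr : r.Finitary) : WeakIdealSystem H where
  cl X := sat P (r.cl X)
  mul_univ_union_subset_cl X := (r.mul_univ_union_subset_cl X).trans (hP.subset_sat _)
  cl_subset_cl X Y h :=
    (sat_mono P ((hP.isRIdeal_sat hr (isRIdeal_cl Y)).cl_subset h)).trans (hP.sat_sat _)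
  smul_cl_subset c X := by
    rintro _ ⟨x, ⟨t, ht, h⟩, rfl⟩
    refine ⟨t, ht, ?_⟩
    have h1 := mul_mem_cl_smul c h
    rwa [mul_left_comm] at h1

variable (hP : r.IsPrimeIdeal P) (hr : r.Finitary)

theorem cl_subset_loc (X : Set H) : r.cl X ⊆ (hP.loc hr).cl X := hP.subset_sat _

theorem loc_cl (X : Set H) : (hP.loc hr).cl (r.cl X) = (hP.loc hr).cl X := by
  change sat P (r.cl (r.cl X)) = _
  rw [show r.cl (r.cl X) = r.cl X from isRIdeal_cl X]
  rfl

theorem loc_subset {X : Set H} (h : X ⊆ P) : (hP.loc hr).cl X ⊆ P :=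
  hP.sat_subset (hP.1.cl_subset h)

theorem mem_loc_ideal {I : Set H} (hI : (hP.loc hr).IsRIdeal I) {t x : H} (ht : t ∉ P)
    (h : t * x ∈ I) : x ∈ I := by
  rw [← show (hP.loc hr).cl I = I from hI]
  exact ⟨t, ht, subset_cl _ h⟩

theorem isRIdeal_of_loc {I : Set H} (hI : (hP.loc hr).IsRIdeal I) : r.IsRIdeal I :=
  isRIdeal_of_cl_subset ((hP.cl_subset_loc hr I).trans hI.subset)

theorem subset_of_loc {I : Set H} (hI : (hP.loc hr).IsRIdeal I) (hne : I ≠ Set.univ) : I ⊆ P := by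
  intro x hx
  by_contra hcon
  exact hI.one_notMem hne (hP.mem_loc_ideal hr hI hcon (by simpa using hx))

/-- Localization of `r`-ideals as a homomorphism of monoids. -/
def locHom : r.RIdeal →* (hP.loc hr).RIdeal where
  toFun I := (hP.loc hr).toRIdeal I.1
  map_one' := RIdeal.ext' (by
    change (hP.loc hr).cl (r.cl {1}) = (hP.loc hr).cl {1}
    rw [hP.loc_cl hr])
  map_mul' I J := RIdeal.ext' (by
    change (hP.loc hr).cl (r.cl (I.1 * J.1)) =
      (hP.loc hr).cl ((hP.loc hr).cl I.1 * (hP.loc hr).cl J.1)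
    rw [hP.loc_cl hr, cl_mul_cl])

theorem val_locHom (I : r.RIdeal) : (hP.locHom hr I).1 = sat P I.1 := by
  change sat P (r.cl I.1) = _
  rw [show r.cl I.1 = I.1 from I.2]

theorem locHom_of_loc {I : Set H} (hI : (hP.loc hr).IsRIdeal I) :
    hP.locHom hr ⟨I, hP.isRIdeal_of_loc hr hI⟩ = ⟨I, hI⟩ := RIdeal.ext' hI

theorem locHom_toRIdeal (X : Set H) : hP.locHom hr (r.toRIdeal X) = (hP.loc hr).toRIdeal X :=
  RIdeal.ext' (hP.loc_cl hr X)

theorem isRIdeal_loc_self : (hP.loc hr).IsRIdeal P :=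
  isRIdeal_of_cl_subset (hP.loc_subset hr subset_rfl)

/-- The greatest proper element of the localized lattice. -/
def top' : (hP.loc hr).RIdeal := ⟨P, hP.isRIdeal_loc_self hr⟩

theorem le_top' {I : (hP.loc hr).RIdeal} (h : I ≠ 1) : I ≤ hP.top' hr :=
  hP.subset_of_loc hr I.2 fun h' => h (RIdeal.eq_one_iff.2 h')

theorem top'_ne_one : hP.top' hr ≠ 1 := fun h => hP.2.1 (RIdeal.eq_one_iff.1 h)

end IsPrimeIdeal

theorem IsPrimeIdeal.sat_subset_of_subset {P Q I : Set H} (hQ : r.IsPrimeIdeal Q) (h : Q ⊆ P) :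
    sat Q (sat P I) ⊆ sat Q I := by
  rintro x ⟨t, ht, u, hu, hx⟩
  exact ⟨u * t, hQ.mul_notMem (fun h' => hu (h h')) ht, by rwa [mul_assoc]⟩

end Saturation

end WeakIdealSystem

open WeakIdealSystem

/-! ### Star operations on a domain: principal ideals and local membership -/

namespace StarOperation

variable {R : Type*} [CommRing R] [IsDomain R] {s : StarOperation R}

theorem zero_mem_cl (X : Set R) : (0 : R) ∈ s.cl X :=
  s.mul_univ_union_subset_cl X (Or.inr fun x => mul_zero x)

theorem zero_mem {I : Set R} (hI : s.IsRIdeal I) : (0 : R) ∈ I := hI ▸ zero_mem_cl I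

theorem mem_cl_singleton {x y : R} : y ∈ s.cl {x} ↔ x ∣ y := by
  have h : s.cl {x} = x • s.cl {1} := by rw [s.smul_cl]; simp
  rw [h, cl_eq_univ_of_one_mem (subset_cl _ (Set.mem_singleton (1 : R)))]
  constructor
  · rintro ⟨c, -, rfl⟩
    exact Dvd.intro c rfl
  · rintro ⟨c, rfl⟩
    exact ⟨c, trivial, rfl⟩

theorem cl_singleton (x : R) : s.cl {x} = {y | x ∣ y} := Set.ext fun _ => mem_cl_singleton

theorem isRIdeal_dvd (s : StarOperation R) (x : R) : s.IsRIdeal {y | x ∣ y} := by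
  rw [← cl_singleton (s := s)]
  exact isRIdeal_cl _

theorem smul_univ (x : R) : x • (Set.univ : Set R) = {y | x ∣ y} := by
  ext y
  constructor
  · rintro ⟨c, -, rfl⟩
    exact Dvd.intro c rfl
  · rintro ⟨c, rfl⟩
    exact ⟨c, trivial, rfl⟩

theorem mul_mem_cl_smul_iff {x a : R} (hx : x ≠ 0) {A : Set R} :
    x * a ∈ s.cl (x • A) ↔ a ∈ s.cl A := by
  refine ⟨fun h => ?_, mul_mem_cl_smul x⟩
  rw [← s.smul_cl] at h
  obtain ⟨b, hb, h⟩ := h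
  rw [← mul_left_cancel₀ hx h]
  exact hb

theorem isRIdeal_zero (s : StarOperation R) : s.IsRIdeal {0} := by
  have h := isRIdeal_dvd s 0
  simpa only [zero_dvd_iff, Set.ofPred_eq_eq_singleton] using h

theorem exists_ne_zero {I : Set R} (hI : s.IsRIdeal I) (h : I ≠ {0}) : ∃ x ∈ I, x ≠ 0 := by
  by_contra! hcon
  exact h (Set.Subset.antisymm hcon (by simpa using zero_mem hI))

theorem ne_singleton_zero {I : Set R} {x : R} (hx : x ∈ I) (h : x ≠ 0) : I ≠ {0} := by
  rintro rfl
  exact h hx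

theorem isRegularElem_iff {x : R} : s.IsRegularElem x ↔ x ≠ 0 := by
  constructor
  · rintro h rfl
    exact zero_ne_one (h.1 0 1 (by simp))
  · intro h
    exact ⟨fun a b hab => mul_left_cancel₀ h hab, fun A => (s.smul_cl x A).symm⟩

theorem isInvertible_iff {I : Set R} : s.IsInvertible I ↔
    s.IsRIdeal I ∧ ∃ (J : Set R) (y : R), y ≠ 0 ∧ s.cl (I * J) = {z | y ∣ z} := by
  simp only [WeakIdealSystem.IsInvertible, isRegularElem_iff, smul_univ]

theorem isPrimeIdeal_zero (s : StarOperation R) : s.IsPrimeIdeal {0} :=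
  ⟨isRIdeal_zero s, fun h => one_ne_zero (h ▸ Set.mem_univ (1 : R) : (1 : R) ∈ ({0} : Set R)),
    fun x y h => by simpa using h⟩

/-- An element of a finite-type star ideal can be tested locally. -/
theorem mem_of_forall_maximal (hfin : s.Finitary) {I : Set R} (hI : s.IsRIdeal I) {x : R}
    (h : ∀ M, s.IsMaximalIdeal M → I ⊆ M → x ∈ sat M I) : x ∈ I := by
  by_contra hcon
  obtain ⟨M, hM, hIM⟩ := hfin.exists_maximal (isRIdeal_colon hI x)
    (fun h1 => hcon (by simpa using (h1 ▸ Set.mem_univ (1 : R) : (1 : R) ∈ {y | x * y ∈ I})))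
  obtain ⟨t, ht, htx⟩ := h M hM (fun y hy => hIM (hI.mul_mem x hy))
  exact ht (hIM (by simpa [mul_comm] using htx))

/-! ### Local consequences of invertibility and modularity -/

/-- If all products ab with a ∈ J, b ∈ B lay in yP, then yR = (JB)_* ⊆ yP, and cancelling y would
give 1 ∈ P. So ab = yu for some u ∉ P, and this a generates J locally: if cb = yd, then uc = ad. -/
theorem exists_local_generator {J P : Set R} (hJ : s.IsInvertible J) (hP : s.IsPrimeIdeal P) :
    ∃ a ∈ J, a ≠ 0 ∧ J ⊆ sat P {y | a ∣ y} := by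
  obtain ⟨-, B, y, hy, h⟩ := isInvertible_iff.1 hJ
  have h1 : ∃ a ∈ J, ∃ b ∈ B, ∃ u, u ∉ P ∧ a * b = y * u := by
    by_contra! hcon
    have h2 : s.cl (J * B) ⊆ s.cl (y • P) := by
      apply cl_mono
      rintro _ ⟨a, ha, b, hb, rfl⟩
      have h3 : a * b ∈ s.cl (J * B) := subset_cl _ (Set.mul_mem_mul ha hb)
      rw [h] at h3
      obtain ⟨u, hu⟩ := h3
      exact ⟨u, by_contra fun h4 => hcon a ha b hb u h4 hu, hu.symm⟩
    rw [h] at h2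
    have h3 : y * 1 ∈ s.cl (y • P) := h2 (by simp)
    rw [mul_mem_cl_smul_iff hy, show s.cl P = P from hP.1] at h3
    exact hP.one_notMem h3
  obtain ⟨a, ha, b, hb, u, hu, hab⟩ := h1
  have hu0 : u ≠ 0 := fun h0 => hu (h0 ▸ zero_mem hP.1)
  have ha0 : a ≠ 0 := by
    rintro rfl
    exact mul_ne_zero hy hu0 (by rw [← hab, zero_mul])
  refine ⟨a, ha, ha0, fun c hc => ⟨u, hu, ?_⟩⟩
  have h3 : c * b ∈ s.cl (J * B) := subset_cl _ (Set.mul_mem_mul hc hb)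
  rw [h] at h3
  obtain ⟨d, hd⟩ := h3
  refine ⟨d, mul_left_cancel₀ hy ?_⟩
  linear_combination c * (-hab) + a * hd

/-- By finite type, y already lies in the closure of finitely many products from JB; their left
factors generate J after cancelling y. -/
theorem isFG_of_isInvertible (hfin : s.Finitary) {J : Set R} (hJ : s.IsInvertible J) :
    s.IsFG J := by
  obtain ⟨hJr, B, y, hy, h⟩ := isInvertible_iff.1 hJ
  have hyc : y ∈ s.cl (J * B) := by rw [h]; exact dvd_rfl
  obtain ⟨F, hFs, hF, hyF⟩ := hfin.exists_finite hyc
  choose! f hf g hg hfg using fun x (hx : x ∈ F) => Set.mem_mul.1 (hFs hx)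
  refine ⟨hJr, f '' F, hF.image f, Set.image_subset_iff.2 hf, ?_⟩
  apply Set.Subset.antisymm
  · intro c hc
    have h1 := mul_mem_cl_smul c hyF
    rw [mul_comm c y] at h1
    refine (mul_mem_cl_smul_iff hy).1 (s.cl_subset_cl _ _ ?_ h1)
    rintro _ ⟨x, hx, rfl⟩
    have h2 : c * g x ∈ s.cl (J * B) := subset_cl _ (Set.mul_mem_mul hc (hg x hx))
    rw [h] at h2
    obtain ⟨d, hd⟩ := h2
    have h3 : c * x = d * (y * f x) := by linear_combination f x * hd - c * hfg x hx
    change c * x ∈ _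
    rw [h3]
    exact mul_mem_cl d (subset_cl _ ⟨f x, Set.mem_image_of_mem f hx, rfl⟩)
  · exact hJr.cl_subset (Set.image_subset_iff.2 hf)

/-- Nakayama's lemma for a principal ideal. -/
theorem mem_loc_of_mem_loc_union_smul (hfin : s.Finitary) (hmod : s.Modular) {P : Set R}
    (hP : s.IsPrimeIdeal P) {Y : Set R} {e : R}
    (h : e ∈ (hP.loc hfin).cl (Y ∪ e • P)) : e ∈ (hP.loc hfin).cl Y := by
  rcases eq_or_ne e 0 with rfl | he
  · exact hP.subset_sat _ (zero_mem_cl _)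
  obtain ⟨t, ht, h⟩ := h
  have heP : s.IsRIdeal (e • P) := by
    change s.cl (e • P) = e • P
    rw [← s.smul_cl, show s.cl P = P from hP.1]
  -- The modular law for eP ⊆ eR. Everything on its right-hand side is divisible by e, so e can be
  -- cancelled.
  have h1 := hmod (e • P) (s.cl Y) {y | e ∣ y} heP (isRIdeal_cl _) (isRIdeal_dvd s e)
    (by rintro _ ⟨x, -, rfl⟩; exact Dvd.intro x rfl)
  have h2 : t * e ∈ s.cl (e • P ∪ s.cl Y) ∩ {y | e ∣ y} :=
    ⟨by rw [cl_union_cl, Set.union_comm]; exact h, Dvd.intro_left t rfl⟩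
  have h3 := h1 h2
  have h4 : e • P ∪ (s.cl Y ∩ {y | e ∣ y}) ⊆ e • (P ∪ {c | e * c ∈ s.cl Y}) := by
    apply Set.union_subset
    · exact Set.smul_set_mono Set.subset_union_left
    · rintro _ ⟨h5, c, rfl⟩
      exact ⟨c, Or.inr h5, rfl⟩
  have h5 := cl_mono h4 h3
  rw [mul_comm, mul_mem_cl_smul_iff he] at h5
  by_contra hcon
  -- After cancellation t lies in the closure of P and the colon of Y_* by e. As t ∉ P, the colon is
  -- not inside P, and an element of it outside P is the required denominator.
  refine ht (hP.1.cl_subset (Set.union_subset subset_rfl ?_) h5)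
  intro c hc
  by_contra hcP
  exact hcon ⟨c, hcP, by rw [mul_comm]; exact hc⟩

/-- Nakayama's lemma for a finitely generated ideal. -/
theorem subset_loc_of_subset_loc_union_mul (hfin : s.Finitary) (hmod : s.Modular) {P : Set R}
    (hP : s.IsPrimeIdeal P) {F : Set R} (hF : F.Finite) {X : Set R}
    (h : F ⊆ (hP.loc hfin).cl (X ∪ F * P)) : F ⊆ (hP.loc hfin).cl X := by
  induction F, hF using Set.Finite.induction_on with
  | empty => exact Set.empty_subset _
  | @insert e F _ _ ih =>
    have h1 : e ∈ (hP.loc hfin).cl (X ∪ F) := by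
      apply mem_loc_of_mem_loc_union_smul hfin hmod hP
      refine cl_subset_cl _ _ _ ?_ (h (Set.mem_insert e F))
      apply Set.union_subset
      · exact (Set.subset_union_left.trans Set.subset_union_left).trans (subset_cl _)
      · rintro _ ⟨a, rfl | ha, b, hb, rfl⟩
        · exact subset_cl _ (Or.inr ⟨b, hb, rfl⟩)
        · change a * b ∈ _
          rw [mul_comm]
          exact mul_mem_cl b (subset_cl _ (Or.inl (Or.inr ha)))
    have h2 : F ⊆ (hP.loc hfin).cl X := by
      apply ih
      refine ((Set.subset_insert e F).trans h).trans (cl_subset_cl _ _ _ ?_)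
      apply Set.union_subset (Set.subset_union_left.trans (subset_cl _))
      rintro _ ⟨a, rfl | ha, b, hb, rfl⟩
      · have h3 := mul_mem_cl_smul b h1
        rw [mul_comm] at h3
        refine cl_subset_cl _ _ _ ?_ h3
        rintro _ ⟨c, hc | hc, rfl⟩
        · exact mul_mem_cl b (subset_cl _ (Or.inl hc))
        · exact subset_cl _ (Or.inr ⟨c, hc, b, hb, mul_comm c b⟩)
      · exact subset_cl _ (Or.inr (Set.mul_mem_mul ha hb))
    refine Set.insert_subset ?_ h2
    exact cl_subset_cl _ _ _ (Set.union_subset (subset_cl _) h2) h1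

/-- A local generator of a radical ideal is not divisible by the square of a nonunit. -/
theorem not_sq_dvd_of_isRadicalIdeal {P : Set R} (hP : s.IsPrimeIdeal P) {p : R} (hp : p ≠ 0)
    (hrad : s.IsRadicalIdeal (sat P {y | p ∣ y})) {u t c : R} (hu : u ∉ P) (ht : t ∈ P) :
    u * p ≠ t ^ 2 * c := by
  intro h
  -- The square of `t * c` is `u * p * c`, so radicality puts `t * c` into the ideal generated
  -- locally by `p`.
  have h1 : t * c ∈ sat P {y | p ∣ y} := by
    refine hrad.2 2 _ (by norm_num) (hP.subset_sat _ ⟨u * c, ?_⟩)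
    linear_combination c * (-h)
  obtain ⟨v, hv, d, hd⟩ := h1
  have hu0 : u ≠ 0 := fun h0 => hu (h0 ▸ zero_mem hP.1)
  have hc : c ≠ 0 := by
    rintro rfl
    rw [mul_zero] at h
    exact mul_ne_zero hu0 hp h
  have h2 : u * v = t * d := by
    have ht0 : t ≠ 0 := by
      rintro rfl
      exact mul_ne_zero hu0 hp (by rw [h]; ring)
    apply mul_left_cancel₀ (mul_ne_zero ht0 hc)
    linear_combination u * hd + d * h
  exact hP.mul_notMem hu hv (h2 ▸ mul_comm t d ▸ hP.1.mul_mem d ht)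

/-- In a localization, a product of radical ideals is radical or contained in the square of the
maximal ideal. -/
theorem isRadicalIdeal_or_le_sq {P : Set R} (hfin : s.Finitary) (hP : s.IsPrimeIdeal P)
    (L : List s.StarIdeal) (hL : ∀ J ∈ L, s.IsRadicalIdeal J.1) :
    s.IsRadicalIdeal (hP.locHom hfin L.prod).1 ∨ hP.locHom hfin L.prod ≤ hP.top' hfin ^ 2 := by
  induction L with
  | nil =>
    left
    rw [List.prod_nil, map_one, RIdeal.val_one]
    exact isRadicalIdeal_univ
  | cons J L ih =>
    rw [List.prod_cons, map_mul]
    by_cases hJ : hP.locHom hfin J = 1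
    · rw [hJ, one_mul]
      exact ih fun K hK => hL K (List.mem_cons_of_mem _ hK)
    by_cases hL1 : hP.locHom hfin L.prod = 1
    · left
      rw [hL1, mul_one, hP.val_locHom]
      exact hP.isRadicalIdeal_sat hfin (hL J List.mem_cons_self)
    · right
      rw [pow_two]
      exact mul_le_mul' (hP.le_top' hfin hJ) (hP.le_top' hfin hL1)

/-! ### Local structure of SP-domains -/

/-- Each radical factor of `I` contains `I`, so locally it contains the radical of `I` and hence
`P`. Thus it is locally either everything or `P`. -/
theorem IsSPDomain.locHom_eq_pow (hsp : s.IsSPDomain) (hfin : s.Finitary) {P : Set R}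
    (hP : s.IsPrimeIdeal P) (I : s.StarIdeal) (h : P ⊆ rad (sat P I.1)) :
    ∃ k : ℕ, hP.locHom hfin I = hP.top' hfin ^ k := by
  obtain ⟨L, hL, rfl⟩ := hsp I
  have h1 : ∀ J ∈ L, hP.locHom hfin J = 1 ∨ hP.locHom hfin J = hP.top' hfin := by
    intro J hJ
    by_cases hJ1 : hP.locHom hfin J = 1
    · exact Or.inl hJ1
    right
    refine le_antisymm (hP.le_top' hfin hJ1) ?_
    change P ⊆ _
    rw [hP.val_locHom]
    refine h.trans (rad_subset_of_subset (hP.isRadicalIdeal_sat hfin (hL J hJ)) ?_)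
    exact sat_mono P (RIdeal.prod_le_of_mem hJ)
  clear hL h
  induction L with
  | nil => exact ⟨0, by simp⟩
  | cons J L ih =>
    obtain ⟨k, hk⟩ := ih fun K hK => h1 K (List.mem_cons_of_mem _ hK)
    rw [List.prod_cons, map_mul, hk]
    rcases h1 J List.mem_cons_self with h2 | h2 <;> rw [h2]
    · exact ⟨k, one_mul _⟩
    · exact ⟨k + 1, (pow_succ' _ _).symm⟩

/-- If no power of x ∈ N were locally in `I`, the monoid of all t·xⁿ with t ∉ N would avoid `I`; a
prime over `I` avoiding it would lie in `N` and miss x, against minimality. -/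
theorem IsPrimeIdeal.subset_rad_sat (hfin : s.Finitary) {N I : Set R} (hN : s.IsPrimeIdeal N)
    (hI : s.IsRIdeal I) (hmin : ∀ Q, s.IsPrimeIdeal Q → I ⊆ Q → Q ⊆ N → Q = N) :
    N ⊆ rad (sat N I) := by
  intro x hx
  by_contra hcon
  let S : Submonoid R :=
    { carrier := {y | ∃ (n : ℕ) (t : R), t ∉ N ∧ y = t * x ^ n}
      one_mem' := ⟨0, 1, hN.one_notMem, by simp⟩
      mul_mem' := by
        rintro _ _ ⟨n, t, ht, rfl⟩ ⟨m, u, hu, rfl⟩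
        exact ⟨n + m, t * u, hN.mul_notMem ht hu, by ring⟩ }
  obtain ⟨Q, hQ, hIQ, hd⟩ := hfin.exists_prime_disjoint hI S (by
    rw [Set.disjoint_right]
    rintro _ ⟨n, t, ht, rfl⟩ hmem
    refine hcon ⟨n + 1, by omega, t, ht, ?_⟩
    rw [pow_succ', mul_left_comm]
    exact hI.mul_mem x hmem)
  have hQN : Q ⊆ N := by
    intro y hy
    by_contra hyN
    exact Set.disjoint_left.1 hd hy ⟨0, y, hyN, by simp⟩
  have h2 := hmin Q hQ hIQ hQN
  subst h2
  exact Set.disjoint_left.1 hd hx ⟨1, 1, hN.one_notMem, by simp⟩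

/-- The principal ideal of a localization generated by `z`. -/
def locPrincipal (hfin : s.Finitary) {P : Set R} (hP : s.IsPrimeIdeal P) (z : R) :
    (hP.loc hfin).RIdeal := (hP.loc hfin).toRIdeal {z}

section

variable (hfin : s.Finitary) {P : Set R} (hP : s.IsPrimeIdeal P)

theorem val_locPrincipal (z : R) : (locPrincipal hfin hP z).1 = sat P {y | z ∣ y} := by
  rw [← cl_singleton (s := s)]
  rfl

theorem locPrincipal_pow (z : R) (n : ℕ) :
    locPrincipal hfin hP z ^ n = locPrincipal hfin hP (z ^ n) := by
  induction n with
  | zero => rw [pow_zero, pow_zero]; rfl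
  | succ n ih =>
    rw [pow_succ, ih, pow_succ]
    apply RIdeal.ext'
    change (hP.loc hfin).cl ((hP.loc hfin).cl _ * (hP.loc hfin).cl _) = (hP.loc hfin).cl _
    rw [cl_mul_cl, Set.singleton_mul_singleton]

theorem locPrincipal_le_iff {z : R} {I : (hP.loc hfin).RIdeal} :
    locPrincipal hfin hP z ≤ I ↔ z ∈ I.1 :=
  ⟨fun h => h (subset_cl (r := hP.loc hfin) {z} rfl), fun h => I.2.cl_subset (by simpa using h)⟩

theorem mul_mem_locPrincipal_mul_iff {z w x : R} (hz : z ≠ 0) :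
    z * x ∈ (locPrincipal hfin hP (z * w)).1 ↔ x ∈ (locPrincipal hfin hP w).1 := by
  rw [val_locPrincipal, val_locPrincipal]
  constructor
  · rintro ⟨t, ht, c, hc⟩
    exact ⟨t, ht, c, mul_left_cancel₀ hz (by linear_combination hc)⟩
  · rintro ⟨t, ht, c, hc⟩
    exact ⟨t, ht, c, by linear_combination z * hc⟩

/-- If `𝔫 ≤ ζ ⊔ 𝔫²`, then `𝔫 ^ m ≤ ζ ^ m ⊔ 𝔫 ^ (m + 1)`. -/
theorem pow_le_pow_sup_pow_succ {r : WeakIdealSystem R} {n z : r.RIdeal} (hz : z ≤ n)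
    (h : n ≤ z ⊔ n ^ 2) (m : ℕ) : n ^ m ≤ z ^ m ⊔ n ^ (m + 1) := by
  induction m with
  | zero => simp
  | succ m ih =>
    calc n ^ (m + 1) = n * n ^ m := pow_succ' _ _
      _ ≤ (z ⊔ n ^ 2) * n ^ m := mul_le_mul_left h _
      _ ≤ z * n ^ m ⊔ n ^ 2 * n ^ m := RIdeal.sup_mul_le _ _ _
      _ ≤ z ^ (m + 1) ⊔ n ^ (m + 1 + 1) := by
        apply sup_le
        · calc z * n ^ m ≤ z * (z ^ m ⊔ n ^ (m + 1)) := mul_le_mul_right ih _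
            _ = (z ^ m ⊔ n ^ (m + 1)) * z := mul_comm _ _
            _ ≤ z ^ m * z ⊔ n ^ (m + 1) * z := RIdeal.sup_mul_le _ _ _
            _ ≤ z ^ (m + 1) ⊔ n ^ (m + 1 + 1) := by
              rw [← pow_succ]
              refine sup_le_sup le_rfl ?_
              rw [pow_succ n (m + 1)]
              exact mul_le_mul_right hz _
        · rw [← pow_add]
          exact le_sup_of_le_right (le_of_eq (by congr 1; omega))

/-- In an SP-domain, a prime minimal over a nonzero finitely generated ideal is locally
principal. -/
theorem IsSPDomain.exists_top'_eq_locPrincipal (hsp : s.IsSPDomain) (hmod : s.Modular)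
    {E : Set R} (hE : E.Finite) (hE0 : ∃ x ∈ E, x ≠ 0) (hEP : E ⊆ P)
    (hmin : ∀ Q, s.IsPrimeIdeal Q → s.cl E ⊆ Q → Q ⊆ P → Q = P) :
    ∃ z, hP.top' hfin = locPrincipal hfin hP z := by
  set n := hP.top' hfin with hn
  have hrad : P ⊆ rad (sat P (s.cl E)) :=
    IsPrimeIdeal.subset_rad_sat hfin hP (isRIdeal_cl E) hmin
  obtain ⟨k, hk⟩ := hsp.locHom_eq_pow hfin hP (s.toRIdeal E) hrad
  rw [hP.locHom_toRIdeal] at hk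
  have hkval : (n ^ k).1 = (hP.loc hfin).cl E := by rw [← hn] at hk; rw [← hk]; rfl
  have hk0 : k ≠ 0 := by
    rintro rfl
    rw [pow_zero] at hk
    exact hP.top'_ne_one hfin (le_antisymm (RIdeal.le_one _) (hk ▸ (hP.top' hfin).2.cl_subset hEP))
  -- Nakayama's lemma applies because `n ^ k` is locally generated by the finite set `E`.
  have hsub : ∀ {X : (hP.loc hfin).RIdeal}, n ^ k ≤ X ⊔ n ^ (k + 1) → n ^ k ≤ X := by
    intro X hX
    rw [RIdeal.le_iff, hkval]
    apply X.2.cl_subset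
    rw [← show (hP.loc hfin).cl X.1 = X.1 from X.2]
    apply subset_loc_of_subset_loc_union_mul hfin hmod hP hE
    rw [RIdeal.le_iff, RIdeal.val_sup, pow_succ, RIdeal.val_mul, hkval, cl_cl_mul, cl_union_cl]
      at hX
    exact (subset_cl _).trans hX
  -- Otherwise `hsub` with the zero ideal for `X` would kill the nonzero element of `E`.
  have hne : n ^ k ≠ n ^ (k + 1) := by
    intro h
    obtain ⟨x, hxE, hx0⟩ := hE0
    have h1 : n ^ k ≤ locPrincipal hfin hP 0 := hsub (h.le.trans le_sup_right)
    have h2 : x ∈ (n ^ k).1 := by rw [hkval]; exact subset_cl _ hxE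
    have h3 := h1 h2
    rw [val_locPrincipal] at h3
    obtain ⟨t, ht, h3⟩ := h3
    have h4 : t * x = 0 := zero_dvd_iff.1 h3
    exact ht ((mul_eq_zero.1 h4).resolve_right hx0 ▸ zero_mem hP.1)
  have hne2 : ¬ n ≤ n ^ 2 := by
    intro h
    apply hne
    apply le_antisymm
    · obtain ⟨j, rfl⟩ := Nat.exists_eq_succ_of_ne_zero hk0
      calc n ^ (j + 1) = n ^ j * n := pow_succ _ _
        _ ≤ n ^ j * n ^ 2 := mul_le_mul_right h _
        _ = n ^ (j + 1 + 1) := by rw [← pow_add]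
    · rw [pow_succ]
      exact RIdeal.mul_le_left _ _
  obtain ⟨z, hzP, hz⟩ := Set.not_subset.1 (show ¬ n.1 ⊆ (n ^ 2).1 from hne2)
  have hzn : locPrincipal hfin hP z ≤ n := (locPrincipal_le_iff hfin hP).2 hzP
  -- The join contains `n ^ 2`, so its radical is `n` or everything and it is a power of `n`. The
  -- exponent is below 2 since z ∉ n², and nonzero since the join is proper.
  have hj : n = locPrincipal hfin hP z ⊔ n ^ 2 := by
    set I := locPrincipal hfin hP z ⊔ n ^ 2 with hI
    have hIn : I ≤ n := sup_le hzn (by rw [pow_two]; exact RIdeal.mul_le_left _ _)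
    have hloc := hP.locHom_of_loc hfin I.2
    obtain ⟨j, hj⟩ := hsp.locHom_eq_pow hfin hP ⟨I.1, hP.isRIdeal_of_loc hfin I.2⟩ (by
      intro x hx
      refine ⟨2, by norm_num, hP.subset_sat _ ?_⟩
      exact RIdeal.le_iff.1 (le_sup_right : n ^ 2 ≤ I) (RIdeal.pow_mem_pow (I := n) hx 2))
    rw [hloc, ← hn] at hj
    change I = n ^ j at hj
    have hzI : locPrincipal hfin hP z ≤ I := le_sup_left
    have h2 : j < 2 := by
      by_contra! hcon
      apply hz
      rw [← locPrincipal_le_iff hfin hP]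
      refine hzI.trans (hj.le.trans ?_)
      obtain ⟨i, rfl⟩ := Nat.exists_eq_add_of_le hcon
      rw [pow_add]
      exact RIdeal.mul_le_left _ _
    have h0 : j ≠ 0 := by
      rintro rfl
      rw [pow_zero] at hj
      exact hP.top'_ne_one hfin (le_antisymm (RIdeal.le_one _) (hj ▸ hIn))
    have h1 : j = 1 := by omega
    rw [hj, h1, pow_one]
  have hz0 : z ≠ 0 := by
    rintro rfl
    exact hz (zero_mem (hP.isRIdeal_of_loc hfin (n ^ 2).2))
  -- Multiplying by z ∈ n and then cancelling z lowers the exponent by one.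
  have hdesc : ∀ m, n ^ (m + 1) ≤ locPrincipal hfin hP z ^ (m + 1) →
      n ^ 1 ≤ locPrincipal hfin hP z ^ 1 := by
    intro m
    induction m with
    | zero => exact id
    | succ m ih =>
      intro h
      refine ih fun x hx => ?_
      have h1 : z * x ∈ (n ^ (m + 1 + 1)).1 := by
        rw [pow_succ' n (m + 1)]
        exact RIdeal.mul_mem_mul hzP hx
      have h2 := h h1
      rw [locPrincipal_pow, pow_succ', mul_mem_locPrincipal_mul_iff hfin hP hz0] at h2
      rw [locPrincipal_pow]
      exact h2
  refine ⟨z, le_antisymm ?_ hzn⟩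
  obtain ⟨j, rfl⟩ := Nat.exists_eq_succ_of_ne_zero hk0
  simpa using hdesc j (hsub (pow_le_pow_sup_pow_succ hzn hj.le (j + 1)))

/-- In an SP-domain, a nonzero principal radical ideal of a localization is its maximal ideal. -/
theorem IsSPDomain.subset_sat_of_isRadicalIdeal (hsp : s.IsSPDomain) (hfin : s.Finitary)
    (hmod : s.Modular) (hP : s.IsPrimeIdeal P) {p : R} (hp0 : p ≠ 0)
    (hrad : s.IsRadicalIdeal (sat P {y | p ∣ y})) : P ⊆ sat P {y | p ∣ y} := by
  intro y hyP
  by_contra hy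
  -- This ideal contains y² but, by Nakayama's lemma, not y locally: `y ^ 2` lies in y • P. So it is
  -- not locally radical, and must fall into the square of `P`.
  obtain ⟨L, hL, hLI⟩ := hsp (s.toRIdeal {p, y ^ 2})
  have hpI : p ∈ (hP.locHom hfin (s.toRIdeal {p, y ^ 2})).1 := by
    rw [hP.val_locHom]
    exact hP.subset_sat _ (subset_cl _ (by simp))
  have hpr := isRadicalIdeal_or_le_sq hfin hP L hL
  rw [hLI] at hpr
  rcases hpr with h | h
  · have h1 : y ∈ (hP.locHom hfin (s.toRIdeal {p, y ^ 2})).1 := by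
      apply h.2 2 y (by norm_num)
      rw [hP.val_locHom]
      exact hP.subset_sat _ (subset_cl _ (by simp))
    rw [hP.locHom_toRIdeal] at h1
    have h2 : y ∈ (hP.loc hfin).cl ({p} ∪ y • P) := by
      refine cl_mono ?_ h1
      rintro _ (rfl | rfl)
      · exact Or.inl rfl
      · exact Or.inr ⟨y, hyP, (pow_two y).symm⟩
    have h3 := mem_loc_of_mem_loc_union_smul hfin hmod hP h2
    apply hy
    rw [← val_locPrincipal hfin hP]
    exact h3
  · have h1 := h hpI
    rw [pow_two, RIdeal.val_mul] at h1
    obtain ⟨t, ht, h1⟩ := h1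
    obtain ⟨F, hFs, hF, h2⟩ := hfin.exists_finite h1
    choose! f hf g hg hfg using fun x (hx : x ∈ F) => Set.mem_mul.1 (hFs hx)
    have hpP : p ∈ P := by
      have h4 : hP.top' hfin ^ 2 ≤ hP.top' hfin := by
        rw [pow_two]
        exact RIdeal.mul_le_left _ _
      exact (h.trans h4) hpI
    -- The finite set contains p and all factors of the products witnessing p ∈ P². Hence p remains
    -- in the square of any prime N over E inside P, and a minimal such N is locally principal.
    set E : Set R := insert p (f '' F ∪ g '' F) with hE
    have hEP : E ⊆ P := by
      apply Set.insert_subset hpP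
      rintro _ (⟨x, hx, rfl⟩ | ⟨x, hx, rfl⟩)
      exacts [hf x hx, hg x hx]
    obtain ⟨N, hN, hEN, hNP, hmin⟩ := exists_minimal_prime hP (hP.1.cl_subset hEP)
    have hEN' : E ⊆ N := (subset_cl E).trans hEN
    obtain ⟨z, hz⟩ := hsp.exists_top'_eq_locPrincipal hfin hN hmod
      (((hF.image f).union (hF.image g)).insert p) ⟨p, Set.mem_insert _ _, hp0⟩ hEN' hmin
    have h3 : p ∈ (hN.top' hfin ^ 2).1 := by
      apply hN.mem_loc_ideal hfin (hN.top' hfin ^ 2).2 (t := t) fun h' => ht (hNP h')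
      rw [pow_two]
      refine (hN.isRIdeal_of_loc hfin (hN.top' hfin * hN.top' hfin).2).cl_subset ?_ h2
      intro x hx
      rw [← hfg x hx]
      exact RIdeal.mul_mem_mul (hEN' (Or.inr (Or.inl ⟨x, hx, rfl⟩)))
        (hEN' (Or.inr (Or.inr ⟨x, hx, rfl⟩)))
    rw [hz, locPrincipal_pow, val_locPrincipal] at h3
    obtain ⟨u, hu, c, hc⟩ := h3
    have hzN : z ∈ N := by
      have h4 : locPrincipal hfin hN z ≤ hN.top' hfin := hz.ge
      exact (locPrincipal_le_iff hfin hN).1 h4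
    refine not_sq_dvd_of_isRadicalIdeal hN hp0 ?_ hu hzN hc
    have h5 := hN.isRadicalIdeal_sat hfin hrad
    have h6 : sat N (sat P {y | p ∣ y}) = sat N {y | p ∣ y} :=
      Set.Subset.antisymm (hN.sat_subset_of_subset hNP) (sat_mono N (hP.subset_sat _))
    rwa [h6] at h5

end

/-! ### Maximal primes, local discrete valuation rings and invertible radicals -/

/-- Every nonzero prime star ideal is maximal and contains an invertible radical star ideal. -/
def PrimesMaximalWithRadical (s : StarOperation R) : Prop :=
  ∀ P : Set R, s.IsPrimeIdeal P → P ≠ {0} →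
    s.IsMaximalIdeal P ∧ ∃ J : Set R, J ⊆ P ∧ s.IsInvertible J ∧ s.IsRadicalIdeal J

/-- `p` generates the maximal ideal of the localization at `P`, which is a discrete valuation
ring. -/
def IsUniformizer (P : Set R) (p : R) : Prop :=
  p ∈ P ∧ p ≠ 0 ∧ ∀ x, x ≠ 0 → ∃ (n : ℕ) (u v : R), u ∉ P ∧ v ∉ P ∧ u * x = v * p ^ n

/-- Nonzero prime star ideals are maximal and locally discrete valuation ideals. -/
def LocallyDVR (s : StarOperation R) : Prop :=
  ∀ P : Set R, s.IsPrimeIdeal P → P ≠ {0} → s.IsMaximalIdeal P ∧ ∃ p, IsUniformizer P p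

theorem isInvertible_singleton {x : R} (hx : x ≠ 0) : s.IsInvertible {y | x ∣ y} := by
  refine isInvertible_iff.2 ⟨isRIdeal_dvd s x, {1}, x, hx, ?_⟩
  rw [← Set.singleton_one.symm, mul_one]
  exact isRIdeal_dvd s x

theorem isInvertible_of_mem_prod {L : List s.StarIdeal} (hL : s.IsInvertible L.prod.1)
    {J : s.StarIdeal} (hJ : J ∈ L) : s.IsInvertible J.1 := by
  obtain ⟨K, hK⟩ := List.dvd_prod hJ
  obtain ⟨-, B, y, hy, h⟩ := isInvertible_iff.1 hL
  refine isInvertible_iff.2 ⟨J.2, K.1 * B, y, hy, ?_⟩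
  rw [← h, hK, RIdeal.val_mul, cl_cl_mul, mul_assoc]

/-- A prime over a product contains a factor, and a factor of the invertible ideal xR is invertible.
-/
theorem exists_invertible_radical_of_prod {P : Set R} (hP : s.IsPrimeIdeal P) {x : R} (hx : x ∈ P)
    (hx0 : x ≠ 0) (h : s.IsProdRadical (s.toRIdeal {x})) :
    ∃ J : Set R, J ⊆ P ∧ s.IsInvertible J ∧ s.IsRadicalIdeal J := by
  obtain ⟨L, hL, hLx⟩ := h
  have hval : (s.toRIdeal {x}).1 = {y | x ∣ y} := cl_singleton x
  have h1 : L.prod.1 ⊆ P := by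
    rw [hLx]
    exact hP.1.cl_subset (by simpa using hx)
  obtain ⟨J, hJ, hJP⟩ := RIdeal.exists_mem_le_prime hP h1
  refine ⟨J.1, hJP, isInvertible_of_mem_prod ?_ hJ, hL J hJ⟩
  rw [hLx, hval]
  exact isInvertible_singleton hx0

theorem sat_eq_of_local_generator {J P : Set R} (hJ : s.IsRIdeal J) (hP : s.IsPrimeIdeal P)
    {a : R} (ha : a ∈ J) (h : J ⊆ sat P {y | a ∣ y}) : sat P {y | a ∣ y} = sat P J := by
  apply Set.Subset.antisymm
  · refine sat_mono P ?_
    rintro _ ⟨c, rfl⟩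
    rw [mul_comm]
    exact hJ.mul_mem c ha
  · exact (sat_mono P h).trans (hP.sat_sat _)

theorem IsSPDomain.primesMaximalWithRadical (hsp : s.IsSPDomain) (hfin : s.Finitary)
    (hmod : s.Modular) : s.PrimesMaximalWithRadical := by
  intro P hP hP0
  obtain ⟨x, hx, hx0⟩ := exists_ne_zero hP.1 hP0
  obtain ⟨J, hJP, hJ, hJr⟩ := exists_invertible_radical_of_prod hP hx hx0 (hsp _)
  refine ⟨?_, J, hJP, hJ, hJr⟩
  obtain ⟨M, hM, hPM⟩ := hfin.exists_maximal hP.1 hP.2.1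
  have hMp := hM.isPrimeIdeal hfin
  obtain ⟨p, hp, hp0, hpJ⟩ := exists_local_generator hJ hMp
  have hsat := sat_eq_of_local_generator hJ.1 hMp hp hpJ
  have hMs := hsp.subset_sat_of_isRadicalIdeal hfin hmod hMp hp0
    (hsat ▸ hMp.isRadicalIdeal_sat hfin hJr)
  -- At `M` the ideal `J` is all of `M`, so each m ∈ M has a multiple t·m ∈ J ⊆ P with t ∉ M ⊇ P.
  have hMP : M ⊆ P := by
    intro m hm
    have h1 := hMs hm
    rw [hsat] at h1
    obtain ⟨t, ht, h1⟩ := h1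
    exact (hP.2.2 _ _ (hJP h1)).resolve_left fun h2 => ht (hPM h2)
  rw [Set.Subset.antisymm hPM hMP]
  exact hM

theorem PrimesMaximalWithRadical.locallyDVR (h3 : s.PrimesMaximalWithRadical)
    (hfin : s.Finitary) : s.LocallyDVR := by
  intro P hP hP0
  obtain ⟨hmax, J, hJP, hJ, hJr⟩ := h3 P hP hP0
  refine ⟨hmax, ?_⟩
  obtain ⟨p, hp, hp0, hpJ⟩ := exists_local_generator hJ hP
  have hsat := sat_eq_of_local_generator hJ.1 hP hp hpJ
  have hrad : s.IsRadicalIdeal (sat P {y | p ∣ y}) := hsat ▸ hP.isRadicalIdeal_sat hfin hJr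
  -- Nonzero primes are maximal, so `P` is minimal over `p` and is locally the radical of the
  -- already radical ideal generated by `p`.
  have hPs : P ⊆ sat P {y | p ∣ y} := by
    have h1 := IsPrimeIdeal.subset_rad_sat hfin hP (isRIdeal_dvd s p) (by
      intro Q hQ hpQ hQP
      exact ((h3 Q hQ (ne_singleton_zero (hpQ dvd_rfl) hp0)).1.2.2 P hP.1 hP.2.1 hQP).symm)
    exact h1.trans (rad_subset_of_subset hrad subset_rfl)
  have step : ∀ (n : ℕ) (x : R), x ∈ sat P {y | p ^ n ∣ y} → x ∉ sat P {y | p ^ (n + 1) ∣ y} →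
      ∃ u v : R, u ∉ P ∧ v ∉ P ∧ u * x = v * p ^ n := by
    rintro n x ⟨u, hu, v, hv⟩ h2
    refine ⟨u, v, hu, fun hvP => h2 ?_, by rw [hv, mul_comm]⟩
    obtain ⟨t, ht, c, hc⟩ := hPs hvP
    exact ⟨t * u, hP.mul_notMem ht hu, c, by linear_combination t * hv + p ^ n * hc⟩
  refine ⟨p, hJP hp, hp0, fun x hx => ?_⟩
  by_cases hxn : ∀ n, x ∈ sat P {y | p ^ n ∣ y}
  · exfalso
    -- Elements outside the intersection have a finite p-order, and orders add, so the intersection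
    -- is prime. If it were nonzero it would equal `P`, and p would be locally divisible by p².
    have hZp : s.IsPrimeIdeal (⋂₀ (Set.range fun n : ℕ => sat P {y | p ^ n ∣ y})) := by
      refine ⟨isRIdeal_sInter ?_, ?_, ?_⟩
      · rintro _ ⟨n, rfl⟩
        exact hP.isRIdeal_sat hfin (isRIdeal_dvd s _)
      · intro h
        obtain ⟨t, ht, c, hc⟩ := Set.mem_sInter.1 (Set.eq_univ_iff_forall.1 h 1) _ ⟨1, rfl⟩
        refine ht ?_
        rw [mul_one, pow_one, mul_comm] at hc
        exact hc ▸ hP.1.mul_mem c (hJP hp)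
      · intro a b hab
        by_contra! hcon
        have hex : ∀ a, a ∉ (⋂₀ (Set.range fun n : ℕ => sat P {y | p ^ n ∣ y})) →
            ∃ (n : ℕ) (u v : R), u ∉ P ∧ v ∉ P ∧ u * a = v * p ^ n := by
          intro a ha
          simp only [Set.sInter_range, Set.mem_iInter, not_forall] at ha
          classical
          have hm := Nat.find_spec ha
          obtain ⟨n, hn⟩ : ∃ n, Nat.find ha = n + 1 := by
            apply Nat.exists_eq_succ_of_ne_zero
            intro h0
            rw [h0] at hm
            exact hm ⟨1, hP.one_notMem, by simp⟩
          rw [hn] at hm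
          exact ⟨n, step n a (not_not.1 (Nat.find_min ha (by omega))) hm⟩
        obtain ⟨n, u, v, hu, hv, h4⟩ := hex a hcon.1
        obtain ⟨m, u', v', hu', hv', h5⟩ := hex b hcon.2
        obtain ⟨t, ht, c, hc⟩ := Set.mem_sInter.1 hab _ ⟨n + m + 1, rfl⟩
        have h6 : t * v * v' = c * u * u' * p := by
          apply mul_left_cancel₀ (pow_ne_zero (n + m) hp0)
          linear_combination u * u' * hc - t * u' * b * h4 - t * v * p ^ n * h5
        exact hP.mul_notMem (hP.mul_notMem ht hv) hv' (h6 ▸ hP.1.mul_mem _ (hJP hp))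
    have hxZ : x ∈ ⋂₀ (Set.range fun n : ℕ => sat P {y | p ^ n ∣ y}) := by
      rintro _ ⟨n, rfl⟩
      exact hxn n
    have hZP : (⋂₀ (Set.range fun n : ℕ => sat P {y | p ^ n ∣ y})) ⊆ P := by
      rintro y hy
      obtain ⟨t, ht, c, hc⟩ := Set.mem_sInter.1 hy _ ⟨1, rfl⟩
      rw [pow_one, mul_comm p c] at hc
      exact (hP.2.2 t y (hc ▸ hP.1.mul_mem c (hJP hp))).resolve_left ht
    have hPZ := (h3 _ hZp (ne_singleton_zero hxZ hx)).1.2.2 P hP.1 hP.2.1 hZP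
    have hp2 : p ∈ ⋂₀ (Set.range fun n : ℕ => sat P {y | p ^ n ∣ y}) := hPZ ▸ hJP hp
    obtain ⟨t, ht, c, hc⟩ := Set.mem_sInter.1 hp2 _ ⟨2, rfl⟩
    exact not_sq_dvd_of_isRadicalIdeal hP hp0 hrad ht (hJP hp) hc
  · push Not at hxn
    classical
    have hm := Nat.find_spec hxn
    obtain ⟨n, hn⟩ : ∃ n, Nat.find hxn = n + 1 := by
      apply Nat.exists_eq_succ_of_ne_zero
      intro h0
      rw [h0] at hm
      exact hm ⟨1, hP.one_notMem, by simp⟩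
    rw [hn] at hm
    exact ⟨n, step n x (not_not.1 (Nat.find_min hxn (by omega))) hm⟩

/-- A finitely generated star ideal that is locally principal is invertible. -/
theorem isInvertible_of_locally_principal (hfin : s.Finitary) {E : Set R}
    (hE0 : ∃ e ∈ E, e ≠ 0)
    (h : ∀ M, s.IsMaximalIdeal M → ∃ a ∈ s.cl E, ∃ t, t ∉ M ∧ ∀ e ∈ E, a ∣ t * e) :
    s.IsInvertible (s.cl E) := by
  -- The inverse is the colon of xR by `E`. That x lies in the closure of the product is tested at
  -- each `M`: if t·x = a·b, then b is in the colon.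
  obtain ⟨x, hxE, hx0⟩ := hE0
  refine isInvertible_iff.2 ⟨isRIdeal_cl E, {b | ∀ e ∈ E, x ∣ b * e}, x, hx0, ?_⟩
  rw [cl_cl_mul]
  apply Set.Subset.antisymm
  · apply (isRIdeal_dvd s x).cl_subset
    rintro _ ⟨e, he, b, hb, rfl⟩
    change x ∣ e * b
    rw [mul_comm]
    exact hb e he
  · have hx : x ∈ s.cl (E * {b | ∀ e ∈ E, x ∣ b * e}) := by
      refine mem_of_forall_maximal hfin (isRIdeal_cl _) fun M hM _ => ?_
      obtain ⟨a, ha, t, ht, h⟩ := h M hM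
      have ht0 : t ≠ 0 := fun h0 => ht (h0 ▸ zero_mem hM.1)
      have ha0 : a ≠ 0 := by
        rintro rfl
        exact mul_ne_zero ht0 hx0 (zero_dvd_iff.1 (h x hxE))
      obtain ⟨b, hb⟩ := h x hxE
      refine ⟨t, ht, ?_⟩
      rw [hb, ← cl_cl_mul]
      refine subset_cl _ (Set.mul_mem_mul ha fun e he => ?_)
      obtain ⟨c, hc⟩ := h e he
      exact ⟨c, mul_left_cancel₀ ha0 (by linear_combination x * hc - e * hb)⟩
    rintro _ ⟨c, rfl⟩
    rw [mul_comm x c]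
    exact mul_mem_cl c hx

theorem LocallyDVR.isInvertible_cl (hD : s.LocallyDVR) (hfin : s.Finitary) {E : Set R}
    (hE : E.Finite) (hE0 : ∃ e ∈ E, e ≠ 0) : s.IsInvertible (s.cl E) := by
  refine isInvertible_of_locally_principal hfin hE0 fun M hM => ?_
  obtain ⟨e₀, he₀, h0⟩ := hE0
  -- If {0} is maximal, the nonzero `e₀` lies outside `M` and serves both as generator and as
  -- denominator.
  by_cases hM0 : M = {0}
  · exact ⟨e₀, subset_cl _ he₀, e₀, fun h => h0 (by simpa [hM0] using h),
      fun e _ => dvd_mul_right _ _⟩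
  obtain ⟨-, p, hp, hp0, hdvr⟩ := hD M (hM.isPrimeIdeal hfin) hM0
  choose! n u hn using hdvr
  -- An element of least order generates locally.
  obtain ⟨a, ⟨haE, ha0⟩, hmin⟩ := Set.exists_min_image {e | e ∈ E ∧ e ≠ 0} n
    (hE.subset fun e he => he.1) ⟨e₀, he₀, h0⟩
  refine ⟨a, subset_cl _ haE, (hM.isPrimeIdeal hfin).exists_common (isRIdeal_dvd s a) hE ?_⟩
  intro e he
  by_cases he0 : e = 0
  · exact ⟨1, (hM.isPrimeIdeal hfin).one_notMem, by simp [he0]⟩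
  obtain ⟨v, hu, hv, h1⟩ := hn e he0
  obtain ⟨w, hu', hw, h2⟩ := hn a ha0
  obtain ⟨k, hk⟩ := Nat.exists_eq_add_of_le (hmin e ⟨he, he0⟩)
  refine ⟨w * u e, (hM.isPrimeIdeal hfin).mul_notMem hw hu, v * p ^ k * u a, ?_⟩
  rw [hk, pow_add] at h1
  linear_combination w * h1 - v * p ^ k * h2

/-- If I ⊆ M, any prime over the nonzero `I` inside `M` is maximal, hence is `M`, so `M` is locally
the radical of `I`. Otherwise an element of `I` outside `M` is the denominator. -/
theorem LocallyDVR.exists_mul_mem_rad (hD : s.LocallyDVR) (hfin : s.Finitary) {M I : Set R}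
    (hM : s.IsPrimeIdeal M) (hI : s.IsRIdeal I) (hI0 : I ≠ {0}) {f : R} (hf : f ∈ M) :
    f ∈ sat M (rad I) := by
  by_cases hIM : I ⊆ M
  · have h1 := IsPrimeIdeal.subset_rad_sat hfin hM hI (by
      intro Q hQ hIQ hQM
      obtain ⟨x, hx, hx0⟩ := exists_ne_zero hI hI0
      exact ((hD Q hQ (ne_singleton_zero (hIQ hx) hx0)).1.2.2 M hM.1 hM.2.1 hQM).symm)
    exact rad_subset_of_subset (hM.isRadicalIdeal_sat hfin (hfin.isRadicalIdeal_rad hI))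
      (sat_mono M (subset_rad I)) (h1 hf)
  · obtain ⟨t, ht, htM⟩ := Set.not_subset.1 hIM
    refine ⟨t, htM, subset_rad I ?_⟩
    rw [mul_comm]
    exact hI.mul_mem f ht

theorem IsInvertible.exists_ne_zero {J : Set R} (hJ : s.IsInvertible J) : ∃ x ∈ J, x ≠ 0 := by
  obtain ⟨a, ha, ha0, -⟩ := exists_local_generator hJ (isPrimeIdeal_zero s)
  exact ⟨a, ha, ha0⟩

theorem rad_eq_self {r : WeakIdealSystem R} {J : Set R} (hJ : r.IsRadicalIdeal J) : rad J = J :=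
  Set.Subset.antisymm (rad_subset_of_subset hJ subset_rfl) (subset_rad J)

theorem PrimesMaximalWithRadical.isFG_rad (h3 : s.PrimesMaximalWithRadical) (hfin : s.Finitary)
    {I : Set R} (hI : s.IsFG I) (hI0 : I ≠ {0}) : s.IsFG (rad I) := by
  have hD := h3.locallyDVR hfin
  obtain ⟨hIr, E, hE, hEI, hIE⟩ := hI
  have hA := hfin.isRadicalIdeal_rad hIr
  -- `C` collects the multipliers that bring the radical into a finitely generated ideal inside it.
  -- Once 1 ∈ C_*, finitely many of them suffice and their finite sets together generate.
  set C : Set R := {c | ∃ F : Set R, F.Finite ∧ F ⊆ rad I ∧ ∀ x ∈ rad I, c * x ∈ s.cl F} with hC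
  have h1 : (1 : R) ∈ s.cl C := by
    by_contra hcon
    obtain ⟨M, hM, hCM⟩ := hfin.exists_maximal (isRIdeal_cl C) (fun h => hcon (h ▸ trivial))
    have hMp := hM.isPrimeIdeal hfin
    have hCM' : C ⊆ M := (subset_cl C).trans hCM
    by_cases hIM : I ⊆ M
    · obtain ⟨x, hx, hx0⟩ := exists_ne_zero hIr hI0
      obtain ⟨-, J, hJM, hJ, hJr⟩ := h3 M hMp (ne_singleton_zero (hIM hx) hx0)
      obtain ⟨-, G, hG, hGJ, hJG⟩ := isFG_of_isInvertible hfin hJ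
      obtain ⟨j, hj, hj0⟩ := IsInvertible.exists_ne_zero hJ
      obtain ⟨t, ht, htF⟩ := hMp.exists_common hA.1 (hE.union hG) (by
        intro f hf
        exact hD.exists_mul_mem_rad hfin hMp hIr hI0
          (hf.elim (fun h => hIM (hEI h)) (fun h => hJM (hGJ h))))
      -- It suffices that `E ∪ G` generates an ideal containing the radical of `I`: then t times the
      -- radical lies in the closure of t • (E ∪ G).
      refine ht (hCM' ⟨t • (E ∪ G), (hE.union hG).smul_set, ?_, fun x hx => ?_⟩)
      · rintro _ ⟨f, hf, rfl⟩
        exact htF f hf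
      · apply mul_mem_cl_smul
        have hJcl : J ⊆ s.cl (E ∪ G) := by
          rw [hJG]
          exact cl_mono Set.subset_union_right
        -- At a maximal `N` over `E ∪ G`, the nonzero radical ideal `J` is locally all of `N`, which
        -- contains the radical of `I`.
        refine mem_of_forall_maximal hfin (isRIdeal_cl _) fun N hN hEN => ?_
        have hNp := hN.isPrimeIdeal hfin
        have hIN : I ⊆ N := by
          rw [hIE]
          exact (cl_mono Set.subset_union_left).trans hEN
        have hxN := hD.exists_mul_mem_rad hfin hNp hJ.1 (ne_singleton_zero hj hj0)
          (rad_subset_of_subset hNp.isRadicalIdeal hIN hx)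
        rw [rad_eq_self hJr] at hxN
        exact sat_mono N hJcl hxN
    · obtain ⟨c, hc, hcM⟩ := Set.not_subset.1 hIM
      refine hcM (hCM' ⟨{c}, Set.finite_singleton c, by simpa using subset_rad I hc, ?_⟩)
      intro x _
      rw [mul_comm]
      exact mul_mem_cl x (subset_cl _ rfl)
  obtain ⟨D, hDC, hDfin, h2⟩ := hfin.exists_finite h1
  choose! F hF hFA hFc using fun c (hc : c ∈ D) => hDC hc
  refine ⟨hA.1, ⋃ c ∈ D, F c, hDfin.biUnion hF, Set.iUnion₂_subset hFA, ?_⟩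
  apply Set.Subset.antisymm
  · intro x hx
    have h4 := mul_mem_cl_smul x h2
    rw [mul_one] at h4
    refine s.cl_subset_cl _ _ ?_ h4
    rintro _ ⟨c, hc, rfl⟩
    change x * c ∈ _
    rw [mul_comm]
    exact cl_mono (Set.subset_biUnion_of_mem (u := F) hc) (hFc c hc x hx)
  · exact hA.1.cl_subset (Set.iUnion₂_subset hFA)

theorem LocallyDVR.isPMD (hD : s.LocallyDVR) (hfin : s.Finitary) : s.IsPMD := by
  rintro I ⟨hI, E, hE, hEI, rfl⟩ hI0
  refine hD.isInvertible_cl hfin hE ?_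
  by_contra! hcon
  refine hI0 (Set.Subset.antisymm ((isRIdeal_zero s).cl_subset hcon) ?_)
  simpa using zero_mem (isRIdeal_cl E)

/-- Suppose y ∈ M outside P, with P ⊆ M. Locally at M let p generate the radical of (x) and q that
of (x, y). Then p = qr with q ∉ P, so r ∈ P, and a local generator t ∈ M of the radical of (q, r)
divides both factors, so t² divides p. -/
theorem primesMaximalWithRadical_of_isInvertible_rad (hfin : s.Finitary)
    (h5 : ∀ I : Set R, s.IsFG I → I ≠ {0} → s.IsInvertible (rad I)) :
    s.PrimesMaximalWithRadical := by
  have hrad : ∀ x y : R, x ≠ 0 → s.IsInvertible (rad (s.cl {x, y})) := by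
    intro x y hx
    refine h5 _ ⟨isRIdeal_cl _, {x, y}, by simp, subset_cl _, rfl⟩ ?_
    exact ne_singleton_zero (subset_cl _ (Set.mem_insert x _)) hx
  have hsub : ∀ {Q : Set R} {x y : R}, s.IsPrimeIdeal Q → x ∈ Q → y ∈ Q →
      rad (s.cl {x, y}) ⊆ Q := by
    intro Q x y hQ hx hy
    exact rad_subset_of_subset hQ.isRadicalIdeal
      (hQ.1.cl_subset (Set.insert_subset hx (by simpa using hy)))
  have hmem : ∀ x y : R, x ∈ rad (s.cl {x, y}) ∧ y ∈ rad (s.cl {x, y}) := fun x y =>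
    ⟨subset_rad _ (subset_cl _ (by simp)), subset_rad _ (subset_cl _ (by simp))⟩
  intro P hP hP0
  obtain ⟨x, hx, hx0⟩ := exists_ne_zero hP.1 hP0
  have hJ := hrad x x hx0
  have hJr := hfin.isRadicalIdeal_rad (isRIdeal_cl (r := s.toWeakIdealSystem) {x, x})
  refine ⟨?_, _, hsub hP hx hx, hJ, hJr⟩
  obtain ⟨M, hM, hPM⟩ := hfin.exists_maximal hP.1 hP.2.1
  have hMp := hM.isPrimeIdeal hfin
  suffices hMP : M ⊆ P by
    rw [Set.Subset.antisymm hPM hMP]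
    exact hM
  intro y hy
  by_contra hyP
  obtain ⟨p, hp, hp0, hpJ⟩ := exists_local_generator hJ hMp
  have hJ' := hrad x y hx0
  obtain ⟨q, hq, hq0, hqJ⟩ := exists_local_generator hJ' hMp
  have hqP : q ∉ P := by
    intro hqP
    obtain ⟨t, ht, h⟩ := hqJ (hmem x y).2
    have h1 : t * y ∈ P := by
      obtain ⟨c, hc⟩ := h
      rw [hc, mul_comm]
      exact hP.1.mul_mem c hqP
    exact hyP ((hP.2.2 _ _ h1).resolve_left fun h2 => ht (hPM h2))
  have hpJ' : p ∈ rad (s.cl {x, y}) := by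
    refine rad_subset_of_subset (hfin.isRadicalIdeal_rad (isRIdeal_cl _)) ?_ hp
    refine (isRIdeal_cl (r := s.toWeakIdealSystem) _).cl_subset ?_ |>.trans (subset_rad _)
    rintro _ (rfl | rfl) <;> exact subset_cl _ (by simp)
  obtain ⟨t₁, ht₁, r, hr⟩ := hqJ hpJ'
  have hrP : r ∈ P := by
    have h1 : q * r ∈ P := hr ▸ hP.1.mul_mem t₁ (hsub hP hx hx hp)
    exact (hP.2.2 _ _ h1).resolve_left hqP
  have hqM := hsub hMp (hPM hx) hy hq
  have hJ'' := hrad q r hq0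
  obtain ⟨t, ht, -, htJ⟩ := exists_local_generator hJ'' hMp
  obtain ⟨t₂, ht₂, q', hq'⟩ := htJ (hmem q r).1
  obtain ⟨t₃, ht₃, r', hr'⟩ := htJ (hmem q r).2
  refine not_sq_dvd_of_isRadicalIdeal hMp hp0
    (sat_eq_of_local_generator hJ.1 hMp hp hpJ ▸ hMp.isRadicalIdeal_sat hfin hJr)
    (hMp.mul_notMem (hMp.mul_notMem ht₁ ht₂) ht₃) (hsub hMp hqM (hPM hrP) ht)
    (c := q' * r') ?_
  linear_combination t₂ * t₃ * hr + t₃ * r * hq' + t * q' * hr'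

theorem PrimesMaximalWithRadical.dim_le_one (h3 : s.PrimesMaximalWithRadical) : s.dim ≤ 1 := by
  rw [WeakIdealSystem.dim, Order.krullDim_le_one_iff]
  rintro ⟨P, hP⟩
  have hPp := isLPrime_iff.1 hP
  by_cases hP0 : P.1 = {0}
  · left
    rintro ⟨Q, hQ⟩ -
    change P.1 ⊆ Q.1
    rw [hP0]
    simpa using zero_mem Q.2
  · right
    rintro ⟨Q, hQ⟩ hPQ
    have hQp := isLPrime_iff.1 hQ
    exact ((h3 P.1 hPp hP0).1.2.2 Q.1 hQp.1 hQp.2.1 hPQ).subset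

theorem primesMaximalWithRadical_of_dim_le_one (hfin : s.Finitary) (hdim : s.dim ≤ 1)
    (h : ∀ I : s.StarIdeal, s.IsInvertible I.1 → s.IsProdRadical I) :
    s.PrimesMaximalWithRadical := by
  intro P hP hP0
  obtain ⟨x, hx, hx0⟩ := exists_ne_zero hP.1 hP0
  constructor
  · obtain ⟨M, hM, hPM⟩ := hfin.exists_maximal hP.1 hP.2.1
    have hMp := hM.isPrimeIdeal hfin
    rw [WeakIdealSystem.dim, Order.krullDim_le_one_iff] at hdim
    rcases hdim ⟨⟨P, hP.1⟩, isLPrime_iff.2 hP⟩ with h1 | h1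
    · have h2 := @h1 ⟨⟨{0}, isRIdeal_zero s⟩, isLPrime_iff.2 (isPrimeIdeal_zero s)⟩
        (show ({0} : Set R) ⊆ P by simpa using zero_mem hP.1)
      have h3 : P ⊆ {0} := h2
      exact (hx0 (h3 hx)).elim
    · have h2 := @h1 ⟨⟨M, hM.1⟩, isLPrime_iff.2 hMp⟩ hPM
      rw [Set.Subset.antisymm hPM h2]
      exact hM
  · refine exists_invertible_radical_of_prod hP hx hx0 (h _ ?_)
    change s.IsInvertible (s.cl {x})
    rw [cl_singleton]
    exact isInvertible_singleton hx0

end StarOperation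

/-! ### Compactly supported upper semicontinuous functions -/

namespace CompactUSC

variable {X : Type*} [TopologicalSpace X]

/-- Composition with a monotone function `φ` such that `φ 0 = 0`. -/
def comp (f : CompactUSC X) (φ : ℕ → ℕ) (hφ : Monotone φ) (h0 : φ 0 = 0) : CompactUSC X where
  toFun x := φ (f.toFun x)
  usc := continuous_of_discreteTopology.comp_upperSemicontinuous f.usc hφ
  cpt := f.cpt.comp_left h0

/-- The indicator function of the support of `f`. -/
def trunc (f : CompactUSC X) : CompactUSC X :=
  f.comp (fun n => min n 1) (fun _ _ h => min_le_min_right 1 h) rfl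

/-- Truncated subtraction of `1`. -/
def pred (f : CompactUSC X) : CompactUSC X :=
  f.comp (fun n => n - 1) (fun _ _ h => Nat.sub_le_sub_right h 1) rfl

theorem trunc_apply (f : CompactUSC X) (x : X) : f.trunc.toFun x = min (f.toFun x) 1 := rfl

theorem pred_apply (f : CompactUSC X) (x : X) : f.pred.toFun x = f.toFun x - 1 := rfl

theorem add_apply (f g : CompactUSC X) (x : X) : (f + g).toFun x = f.toFun x + g.toFun x := rfl

theorem trunc_add_pred (f : CompactUSC X) : f.trunc + f.pred = f := by
  ext x
  rw [add_apply, trunc_apply, pred_apply]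
  omega

theorem exists_bound (f : CompactUSC X) : ∃ n, ∀ x, f.toFun x ≤ n := by
  obtain ⟨n, hn⟩ := (f.usc.upperSemicontinuousOn _).bddAbove_of_isCompact f.cpt
  refine ⟨n, fun x => ?_⟩
  by_cases hx : f.toFun x = 0
  · simp [hx]
  · exact hn ⟨x, subset_tsupport _ hx, rfl⟩

/-- An upper semicontinuous function is bounded on its compact support, and each application of
`pred` lowers the bound. -/
theorem induction {p : CompactUSC X → Prop} (zero : ∀ f, (∀ x, f.toFun x = 0) → p f)
    (step : ∀ f, p f.pred → p f) (f : CompactUSC X) : p f := by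
  obtain ⟨n, hn⟩ := f.exists_bound
  induction n generalizing f with
  | zero => exact zero f fun x => Nat.le_zero.1 (hn x)
  | succ n ih => exact step f (ih f.pred fun x => by rw [pred_apply]; have := hn x; omega)

/-- The zero function. -/
def zero' (X : Type*) [TopologicalSpace X] : CompactUSC X :=
  ⟨fun _ => 0, upperSemicontinuous_const, HasCompactSupport.zero⟩

theorem le_iff {f g : CompactUSC X} : f ≤ g ↔ ∀ x, g.toFun x ≤ f.toFun x := Iff.rfl

end CompactUSC

namespace StarOperation

variable {R : Type*} [CommRing R] [IsDomain R] {s : StarOperation R}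

/-! ### The inverse topology -/

theorem isOpen_setOf_subset (hfin : s.Finitary) {E : Set R} (hE : E.Finite) :
    IsOpen {M : s.StarMax | E ⊆ M.1.1} := by
  apply TopologicalSpace.isOpen_generateFrom_of_mem
  refine ⟨s.toRIdeal E, hfin.isCompactElement_iff.2 ⟨E, hE, rfl⟩, ?_⟩
  ext M
  exact ⟨fun h => M.1.2.cl_subset h, fun h => (subset_cl E).trans h⟩

theorem exists_finite_of_isOpen (hfin : s.Finitary) {U : Set s.StarMax} (hU : IsOpen U)
    {N : s.StarMax} (hN : N ∈ U) :
    ∃ E : Set R, E.Finite ∧ E ⊆ N.1.1 ∧ ∀ M : s.StarMax, E ⊆ M.1.1 → M ∈ U := by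
  induction hU with
  | basic V hV =>
    obtain ⟨I, hI, rfl⟩ := hV
    obtain ⟨E, hE, rfl⟩ := hfin.isCompactElement_iff.1 hI
    exact ⟨E, hE, (subset_cl E).trans hN, fun M hM => M.1.2.cl_subset hM⟩
  | univ => exact ⟨∅, Set.finite_empty, Set.empty_subset _, fun _ _ => trivial⟩
  | inter V W _ _ ihV ihW =>
    obtain ⟨E, hE, hEN, h1⟩ := ihV hN.1
    obtain ⟨F, hF, hFN, h2⟩ := ihW hN.2
    exact ⟨E ∪ F, hE.union hF, Set.union_subset hEN hFN, fun M hM =>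
      ⟨h1 M (Set.subset_union_left.trans hM), h2 M (Set.subset_union_right.trans hM)⟩⟩
  | sUnion S _ ih =>
    obtain ⟨V, hV, hNV⟩ := hN
    obtain ⟨E, hE, hEN, h1⟩ := ih V hV hNV
    exact ⟨E, hE, hEN, fun M hM => ⟨V, hV, h1 M hM⟩⟩

theorem StarMax.isPrimeIdeal (hfin : s.Finitary) (M : s.StarMax) : s.IsPrimeIdeal M.1.1 :=
  M.2.1.isPrimeIdeal hfin

/-- The limit of an ultrafilter is the set of elements lying in almost all `M`. It is a prime
`*`-ideal by finite type, and it contains x ≠ 0, so it is a point of the space. -/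
theorem LocallyDVR.isCompact_setOf_mem (hD : s.LocallyDVR) (hfin : s.Finitary) {x : R}
    (hx : x ≠ 0) : IsCompact {M : s.StarMax | x ∈ M.1.1} := by
  rw [isCompact_iff_ultrafilter_le_nhds]
  intro f hf
  set N : Set R := {r | {M : s.StarMax | r ∈ M.1.1} ∈ f} with hN
  have hfinite : ∀ F : Set R, F.Finite → F ⊆ N → {M : s.StarMax | F ⊆ M.1.1} ∈ f := by
    intro F hF hFN
    have h1 : (⋂ r ∈ F, {M : s.StarMax | r ∈ M.1.1}) ∈ (f : Filter s.StarMax) :=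
      (Filter.biInter_mem hF).2 hFN
    refine Filter.mem_of_superset h1 fun M hM r hr => ?_
    exact Set.mem_iInter₂.1 hM r hr
  have hxN : x ∈ N := Filter.le_principal_iff.1 hf
  have hNp : s.IsPrimeIdeal N := by
    refine ⟨isRIdeal_of_cl_subset fun y hy => ?_, fun h => ?_, fun a b hab => ?_⟩
    · obtain ⟨F, hFN, hF, hy⟩ := hfin.exists_finite hy
      exact Filter.mem_of_superset (hfinite F hF hFN) fun M hM => M.1.2.cl_subset hM hy
    · have h1 : {M : s.StarMax | (1 : R) ∈ M.1.1} ∈ f := Set.eq_univ_iff_forall.1 h 1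
      obtain ⟨M, hM⟩ := f.nonempty_of_mem h1
      exact (StarMax.isPrimeIdeal hfin M).one_notMem hM
    · refine Ultrafilter.union_mem_iff.1 (Filter.mem_of_superset hab fun M hM => ?_)
      exact (StarMax.isPrimeIdeal hfin M).2.2 a b hM
  have hN0 := ne_singleton_zero hxN hx
  refine ⟨⟨⟨N, hNp.1⟩, (hD N hNp hN0).1, hN0⟩, hxN, ?_⟩
  refine le_nhds_iff.2 fun U hNU hU => ?_
  obtain ⟨E, hE, hEN, h1⟩ := exists_finite_of_isOpen hfin hU hNU
  exact Filter.mem_of_superset (hfinite E hE hEN) h1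

/-! ### The valuations -/

section Valuations

theorem LocallyDVR.exists_isUniformizer (hD : s.LocallyDVR) (hfin : s.Finitary) (M : s.StarMax) :
    ∃ p, IsUniformizer M.1.1 p :=
  (hD M.1.1 (StarMax.isPrimeIdeal hfin M) M.2.2).2

variable (hD : s.LocallyDVR) (hfin : s.Finitary) (M : s.StarMax)

/-- A uniformizer of the localization at `M`. -/
noncomputable def unif : R := (hD.exists_isUniformizer hfin M).choose

theorem unif_spec : IsUniformizer M.1.1 (unif hD hfin M) :=
  (hD.exists_isUniformizer hfin M).choose_spec

open Classical in
/-- The valuation of the localization at `M`, with value `0` at `0`. -/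
noncomputable def ord (x : R) : ℕ :=
  if hx : x ≠ 0 then ((unif_spec hD hfin M).2.2 x hx).choose else 0

theorem ord_spec {x : R} (hx : x ≠ 0) :
    ∃ u v : R, u ∉ M.1.1 ∧ v ∉ M.1.1 ∧ u * x = v * unif hD hfin M ^ ord hD hfin M x := by
  rw [ord, dif_pos hx]
  exact ((unif_spec hD hfin M).2.2 x hx).choose_spec

theorem le_ord_iff {x : R} (hx : x ≠ 0) {n : ℕ} :
    n ≤ ord hD hfin M x ↔ x ∈ sat M.1.1 {y | unif hD hfin M ^ n ∣ y} := by
  obtain ⟨u, v, hu, hv, h⟩ := ord_spec hD hfin M hx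
  have hMp := StarMax.isPrimeIdeal hfin M
  have hp := unif_spec hD hfin M
  constructor
  · intro hn
    exact ⟨u, hu, h ▸ Dvd.dvd.mul_left (pow_dvd_pow _ hn) v⟩
  · rintro ⟨t, ht, c, hc⟩
    by_contra! hcon
    obtain ⟨k, rfl⟩ := Nat.exists_eq_add_of_lt hcon
    have h1 : t * v = u * c * unif hD hfin M ^ k * unif hD hfin M := by
      apply mul_left_cancel₀ (pow_ne_zero (ord hD hfin M x) hp.2.1)
      linear_combination u * hc - t * h
    exact hMp.mul_notMem ht hv (h1 ▸ hMp.1.mul_mem _ hp.1)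

theorem ord_eq {x u v : R} {n : ℕ} (hx : x ≠ 0) (hu : u ∉ M.1.1) (hv : v ∉ M.1.1)
    (h : u * x = v * unif hD hfin M ^ n) : ord hD hfin M x = n := by
  have hMp := StarMax.isPrimeIdeal hfin M
  have hp := unif_spec hD hfin M
  apply le_antisymm
  · by_contra! hcon
    obtain ⟨t, ht, c, hc⟩ := (le_ord_iff hD hfin M hx).1 (Nat.succ_le_of_lt hcon)
    rw [Nat.succ_eq_add_one, pow_succ] at hc
    have h1 : t * v = u * c * unif hD hfin M := by
      apply mul_left_cancel₀ (pow_ne_zero n hp.2.1)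
      linear_combination u * hc - t * h
    exact hMp.mul_notMem ht hv (h1 ▸ hMp.1.mul_mem _ hp.1)
  · exact (le_ord_iff hD hfin M hx).2 ⟨u, hu, v, by rw [h, mul_comm]⟩

theorem ord_mul {x y : R} (hx : x ≠ 0) (hy : y ≠ 0) :
    ord hD hfin M (x * y) = ord hD hfin M x + ord hD hfin M y := by
  obtain ⟨u, v, hu, hv, h⟩ := ord_spec hD hfin M hx
  obtain ⟨u', v', hu', hv', h'⟩ := ord_spec hD hfin M hy
  have hMp := StarMax.isPrimeIdeal hfin M
  refine ord_eq hD hfin M (mul_ne_zero hx hy) (hMp.mul_notMem hu hu') (hMp.mul_notMem hv hv') ?_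
  rw [pow_add]
  linear_combination u' * y * h + v * unif hD hfin M ^ ord hD hfin M x * h'

theorem ord_pow {x : R} (hx : x ≠ 0) (n : ℕ) : ord hD hfin M (x ^ n) = n * ord hD hfin M x := by
  induction n with
  | zero =>
    have h1 := (StarMax.isPrimeIdeal hfin M).one_notMem
    rw [zero_mul, pow_zero]
    exact ord_eq hD hfin M one_ne_zero h1 h1 (by simp)
  | succ n ih => rw [pow_succ, ord_mul hD hfin M (pow_ne_zero n hx) hx, ih, Nat.succ_mul]

theorem ord_eq_zero {t : R} (ht : t ∉ M.1.1) : ord hD hfin M t = 0 :=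
  ord_eq hD hfin M (fun h => ht (h ▸ zero_mem M.1.2)) (StarMax.isPrimeIdeal hfin M).one_notMem ht
    (by simp)

theorem ord_unif : ord hD hfin M (unif hD hfin M) = 1 := by
  have h1 := (StarMax.isPrimeIdeal hfin M).one_notMem
  exact ord_eq hD hfin M (unif_spec hD hfin M).2.1 h1 h1 (by simp)

theorem ord_pos {x : R} (hx : x ≠ 0) (hxM : x ∈ M.1.1) : 1 ≤ ord hD hfin M x := by
  obtain ⟨u, v, hu, hv, h⟩ := ord_spec hD hfin M hx
  by_contra! hcon
  rw [Nat.lt_one_iff.1 hcon, pow_zero, mul_one] at h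
  exact hv (h ▸ M.1.2.mul_mem u hxM)

theorem mem_sat_of_ord_le {x y : R} (hx : x ≠ 0) (hy : y ≠ 0)
    (h : ord hD hfin M x ≤ ord hD hfin M y) : y ∈ sat M.1.1 {z | x ∣ z} := by
  obtain ⟨u, v, hu, hv, h1⟩ := ord_spec hD hfin M hx
  obtain ⟨u', v', hu', hv', h2⟩ := ord_spec hD hfin M hy
  obtain ⟨k, hk⟩ := Nat.exists_eq_add_of_le h
  refine ⟨v * u', (StarMax.isPrimeIdeal hfin M).mul_notMem hv hu',
    v' * unif hD hfin M ^ k * u, ?_⟩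
  rw [hk, pow_add] at h2
  linear_combination v * h2 - v' * unif hD hfin M ^ k * h1

/-- Elements of valuation at least `n` form a star ideal. -/
theorem le_ord_of_mem_cl {X : Set R} {n : ℕ} (h : ∀ x ∈ X, x ≠ 0 → n ≤ ord hD hfin M x) {y : R}
    (hy : y ∈ s.cl X) (hy0 : y ≠ 0) : n ≤ ord hD hfin M y := by
  have hMp := StarMax.isPrimeIdeal hfin M
  have hc := hMp.isRIdeal_sat hfin (isRIdeal_dvd s (unif hD hfin M ^ n))
  rw [le_ord_iff hD hfin M hy0]
  refine hc.cl_subset (fun x hx => ?_) hy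
  by_cases hx0 : x = 0
  · rw [hx0]
    exact zero_mem hc
  · exact (le_ord_iff hD hfin M hx0).1 (h x hx hx0)

/-- The least value at `M` of a nonzero element of `I`. -/
noncomputable def wt (I : s.StarIdeal) (M : s.StarMax) : ℕ :=
  sInf {n | ∃ x ∈ I.1, x ≠ 0 ∧ ord hD hfin M x = n}

variable {M}

theorem wt_le {I : s.StarIdeal} {x : R} (hx : x ∈ I.1) (hx0 : x ≠ 0) :
    wt hD hfin I M ≤ ord hD hfin M x := Nat.sInf_le ⟨x, hx, hx0, rfl⟩

theorem exists_ord_eq_wt {I : s.StarIdeal} (hI : I.1 ≠ {0}) (M : s.StarMax) :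
    ∃ x ∈ I.1, x ≠ 0 ∧ ord hD hfin M x = wt hD hfin I M := by
  obtain ⟨x, hx, hx0⟩ := exists_ne_zero I.2 hI
  exact Nat.sInf_mem (s := {n | ∃ x ∈ I.1, x ≠ 0 ∧ ord hD hfin M x = n}) ⟨_, x, hx, hx0, rfl⟩

/-- Membership is tested only at maximal ideals containing `I`; these are nonzero, so they carry
valuations. -/
theorem mem_of_wt_le {I : s.StarIdeal} (hI : I.1 ≠ {0}) {x : R} (hx : x ≠ 0)
    (h : ∀ M, wt hD hfin I M ≤ ord hD hfin M x) : x ∈ I.1 := by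
  refine mem_of_forall_maximal hfin I.2 fun M hM hIM => ?_
  obtain ⟨y, hy, hy0⟩ := exists_ne_zero I.2 hI
  set M' : s.StarMax := ⟨⟨M, hM.1⟩, hM, ne_singleton_zero (hIM hy) hy0⟩
  obtain ⟨z, hz, hz0, hzw⟩ := exists_ord_eq_wt hD hfin hI M'
  obtain ⟨t, ht, c, hc⟩ := mem_sat_of_ord_le hD hfin M' hz0 hx (hzw.le.trans (h M'))
  refine ⟨t, ht, ?_⟩
  rw [hc, mul_comm]
  exact I.2.mul_mem c hz

theorem le_iff_wt_le {I J : s.StarIdeal} (hI : I.1 ≠ {0}) (hJ : J.1 ≠ {0}) :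
    I ≤ J ↔ ∀ M, wt hD hfin J M ≤ wt hD hfin I M := by
  constructor
  · intro h M
    obtain ⟨x, hx, hx0, hxw⟩ := exists_ord_eq_wt hD hfin hI M
    rw [← hxw]
    exact wt_le hD hfin (h hx) hx0
  · intro h x hx
    by_cases hx0 : x = 0
    · rw [hx0]
      exact zero_mem J.2
    · exact mem_of_wt_le hD hfin hJ hx0 fun M => (h M).trans (wt_le hD hfin hx hx0)

theorem mul_ne_singleton_zero {I J : s.StarIdeal} (hI : I.1 ≠ {0}) (hJ : J.1 ≠ {0}) :
    (I * J).1 ≠ {0} := by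
  obtain ⟨x, hx, hx0⟩ := exists_ne_zero I.2 hI
  obtain ⟨y, hy, hy0⟩ := exists_ne_zero J.2 hJ
  exact ne_singleton_zero (RIdeal.mul_mem_mul hx hy) (mul_ne_zero hx0 hy0)

theorem wt_mul {I J : s.StarIdeal} (hI : I.1 ≠ {0}) (hJ : J.1 ≠ {0}) (M : s.StarMax) :
    wt hD hfin (I * J) M = wt hD hfin I M + wt hD hfin J M := by
  apply le_antisymm
  · obtain ⟨x, hx, hx0, hxw⟩ := exists_ord_eq_wt hD hfin hI M
    obtain ⟨y, hy, hy0, hyw⟩ := exists_ord_eq_wt hD hfin hJ M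
    rw [← hxw, ← hyw, ← ord_mul hD hfin M hx0 hy0]
    exact wt_le hD hfin (RIdeal.mul_mem_mul hx hy) (mul_ne_zero hx0 hy0)
  · obtain ⟨z, hz, hz0, hzw⟩ := exists_ord_eq_wt hD hfin (mul_ne_singleton_zero hI hJ) M
    rw [← hzw]
    refine le_ord_of_mem_cl hD hfin M ?_ hz hz0
    rintro _ ⟨x, hx, y, hy, rfl⟩ h0
    change x * y ≠ 0 at h0
    change _ ≤ ord hD hfin M (x * y)
    rw [ord_mul hD hfin M (left_ne_zero_of_mul h0) (right_ne_zero_of_mul h0)]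
    exact add_le_add (wt_le hD hfin hx (left_ne_zero_of_mul h0))
      (wt_le hD hfin hy (right_ne_zero_of_mul h0))

/-- By maximality 1 lies in the closure of M ∪ {t}, hence of a finite subset. No proper ideal
contains both t and the part of that subset in M. -/
theorem exists_finite_separating (hfin : s.Finitary) (M : s.StarMax) {t : R} (ht : t ∉ M.1.1) :
    ∃ G : Set R, G.Finite ∧ G ⊆ M.1.1 ∧ ∀ N : s.StarMax, G ⊆ N.1.1 → t ∉ N.1.1 := by
  have h1 : (1 : R) ∈ s.cl (M.1.1 ∪ {t}) := by
    by_contra hcon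
    have h2 := M.2.1.2.2 _ (isRIdeal_cl (M.1.1 ∪ {t})) (fun h => hcon (h ▸ trivial))
      (Set.subset_union_left.trans (subset_cl _))
    exact ht (h2 ▸ subset_cl _ (Or.inr rfl))
  obtain ⟨F, hF, hFfin, h2⟩ := hfin.exists_finite h1
  refine ⟨F ∩ M.1.1, hFfin.inter_of_left _, Set.inter_subset_right, fun N hN htN => ?_⟩
  refine (StarMax.isPrimeIdeal hfin N).one_notMem (N.1.2.cl_subset (fun f hf => ?_) h2)
  rcases hF hf with h | rfl
  · exact hN ⟨hf, h⟩
  · exact htN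

theorem upperSemicontinuous_wt (h3 : s.PrimesMaximalWithRadical) {I : s.StarIdeal}
    (hI : I.1 ≠ {0}) : UpperSemicontinuous (wt hD hfin I) := by
  intro M y hy
  obtain ⟨x, hx, hx0, hxw⟩ := exists_ord_eq_wt hD hfin hI M
  have hMp := StarMax.isPrimeIdeal hfin M
  obtain ⟨-, J, hJM, hJ, hJr⟩ := h3 M.1.1 hMp M.2.2
  obtain ⟨-, E, hE, hEJ, hJE⟩ := isFG_of_isInvertible hfin hJ
  obtain ⟨j, hj, hj0⟩ := IsInvertible.exists_ne_zero hJ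
  set k := wt hD hfin I M with hk
  -- Elements of `E` have order at least 1 at `M`, so their k-th powers have order at least k, the
  -- order of `x`.
  obtain ⟨t, ht, htE⟩ := hMp.exists_common (isRIdeal_dvd s x) (hE.image (· ^ k)) (by
    rintro _ ⟨e, he, rfl⟩
    by_cases he0 : e ^ k = 0
    · change e ^ k ∈ _
      rw [he0]
      exact hMp.subset_sat _ (dvd_zero x)
    · apply mem_sat_of_ord_le hD hfin M hx0 he0
      by_cases hk0 : k = 0
      · rw [hxw, hk0]
        exact Nat.zero_le _
      · have he1 : e ≠ 0 := fun h => he0 (by rw [h, zero_pow hk0])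
        rw [hxw, ord_pow hD hfin M he1]
        exact Nat.le_mul_of_pos_right k (ord_pos hD hfin M he1 (hJM (hEJ he))))
  obtain ⟨G, hG, hGM, hsep⟩ := exists_finite_separating hfin M ht
  refine Filter.mem_of_superset ((isOpen_setOf_subset hfin (hE.union hG)).mem_nhds
    (Set.union_subset (hEJ.trans hJM) hGM)) fun N hN => ?_
  have hEN : E ⊆ N.1.1 := Set.subset_union_left.trans hN
  have htN := hsep N (Set.subset_union_right.trans hN)
  have hNp := StarMax.isPrimeIdeal hfin N
  refine lt_of_le_of_lt ?_ hy
  refine (wt_le hD hfin hx hx0).trans ?_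
  -- `J` is locally all of `N`, so the generators cannot all have order at least 2 at `N`. A
  -- generator e of order 1 bounds the order of x by k, as x divides t·eᵏ and t ∉ N.
  have hex : ∃ e ∈ E, e ≠ 0 ∧ ord hD hfin N e = 1 := by
    by_contra! hcon
    obtain ⟨u, hu, huJ⟩ := hD.exists_mul_mem_rad hfin hNp hJ.1 (ne_singleton_zero hj hj0)
      (unif_spec hD hfin N).1
    rw [rad_eq_self hJr, hJE] at huJ
    have hu0 : u ≠ 0 := fun h => hu (h ▸ zero_mem N.1.2)
    have hp0 := (unif_spec hD hfin N).2.1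
    have h2 := le_ord_of_mem_cl hD hfin N (n := 2) (fun e he he0 => by
      have h3 := ord_pos hD hfin N he0 (hEN he)
      have h4 := hcon e he he0
      omega) huJ (mul_ne_zero hu0 hp0)
    rw [ord_mul hD hfin N hu0 hp0, ord_eq_zero hD hfin N hu, ord_unif] at h2
    omega
  obtain ⟨e, he, he0, he1⟩ := hex
  obtain ⟨c, hc⟩ := htE _ ⟨e, he, rfl⟩
  change t * e ^ k = x * c at hc
  have ht0 : t ≠ 0 := fun h => ht (h ▸ zero_mem M.1.2)
  have h0 : t * e ^ k ≠ 0 := mul_ne_zero ht0 (pow_ne_zero k he0)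
  have hc0 : c ≠ 0 := by
    rintro rfl
    exact h0 (by rw [hc, mul_zero])
  calc ord hD hfin N x ≤ ord hD hfin N x + ord hD hfin N c := Nat.le_add_right _ _
    _ = ord hD hfin N (t * e ^ k) := by rw [hc, ord_mul hD hfin N hx0 hc0]
    _ = k := by
      rw [ord_mul hD hfin N ht0 (pow_ne_zero k he0), ord_eq_zero hD hfin N htN, ord_pow hD hfin N he0,
        he1, zero_add, mul_one]

theorem hasCompactSupport_wt (h3 : s.PrimesMaximalWithRadical) {I : s.StarIdeal}
    (hI : I.1 ≠ {0}) : HasCompactSupport (wt hD hfin I) := by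
  obtain ⟨x, hx, hx0⟩ := exists_ne_zero I.2 hI
  have hcl : IsClosed (wt hD hfin I ⁻¹' Set.Ici 1) :=
    upperSemicontinuous_iff_isClosed_preimage.1 (upperSemicontinuous_wt hD hfin h3 hI) 1
  refine HasCompactSupport.intro' (K := wt hD hfin I ⁻¹' Set.Ici 1) ?_ hcl fun M hM => ?_
  · refine (hD.isCompact_setOf_mem hfin hx0).of_isClosed_subset hcl fun M hM => ?_
    by_contra hcon
    have h1 := wt_le hD hfin (M := M) hx hx0
    rw [ord_eq_zero hD hfin M hcon] at h1
    have h2 : 1 ≤ wt hD hfin I M := hM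
    omega
  · have h2 : ¬ 1 ≤ wt hD hfin I M := hM
    omega

/-- The function in `U(*-max(R))` attached to a nonzero star ideal. -/
noncomputable def wtUSC (h3 : s.PrimesMaximalWithRadical) (I : s.StarIdeal) (hI : I.1 ≠ {0}) :
    CompactUSC s.StarMax :=
  ⟨wt hD hfin I, upperSemicontinuous_wt hD hfin h3 hI, hasCompactSupport_wt hD hfin h3 hI⟩

/-- The ideal is the intersection of the maximal ideals in the support of `f`. Compactness supplies
a nonzero element t in all of them, and closedness keeps the value 0 off the support. -/
theorem exists_wt_eq_of_le_one (f : CompactUSC s.StarMax) (hf : ∀ M, f.toFun M ≤ 1) :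
    ∃ I : s.StarIdeal, I.1 ≠ {0} ∧ ∀ M, wt hD hfin I M = f.toFun M := by
  set C : Set s.StarMax := f.toFun ⁻¹' Set.Ici 1 with hC
  have hCcl : IsClosed C := upperSemicontinuous_iff_isClosed_preimage.1 f.usc 1
  have hCc : IsCompact C := f.cpt.isCompact.of_isClosed_subset hCcl fun M hM =>
    subset_tsupport _ (Nat.one_le_iff_ne_zero.1 hM)
  obtain ⟨t, ht0, htC⟩ : ∃ t : R, t ≠ 0 ∧ ∀ M ∈ C, t ∈ M.1.1 := by
    refine hCc.induction_on (p := fun S => ∃ t : R, t ≠ 0 ∧ ∀ M ∈ S, t ∈ M.1.1) ?_ ?_ ?_ ?_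
    · exact ⟨1, one_ne_zero, by simp⟩
    · rintro S T hST ⟨t, ht, h⟩
      exact ⟨t, ht, fun M hM => h M (hST hM)⟩
    · rintro S T ⟨t, ht, h⟩ ⟨u, hu, h'⟩
      refine ⟨t * u, mul_ne_zero ht hu, fun M hM => ?_⟩
      rcases hM with hM | hM
      · rw [mul_comm]
        exact M.1.2.mul_mem u (h M hM)
      · exact M.1.2.mul_mem t (h' M hM)
    · intro M _
      obtain ⟨x, hx, hx0⟩ := exists_ne_zero M.1.2 M.2.2
      refine ⟨{N | {x} ⊆ N.1.1}, mem_nhdsWithin_of_mem_nhds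
        ((isOpen_setOf_subset hfin (Set.finite_singleton x)).mem_nhds (by simpa using hx)),
        x, hx0, fun N hN => hN rfl⟩
  set I : Set R := ⋂₀ ((fun M : s.StarMax => M.1.1) '' C) with hI
  have hIr : s.IsRIdeal I := isRIdeal_sInter (by rintro _ ⟨M, -, rfl⟩; exact M.1.2)
  have hmem : ∀ {x}, x ∈ I ↔ ∀ M ∈ C, x ∈ M.1.1 := by
    intro x
    simp [hI]
  have hradC : ∀ M ∈ C, rad {y | t ∣ y} ⊆ M.1.1 := by
    intro M hM
    refine rad_subset_of_subset (StarMax.isPrimeIdeal hfin M).isRadicalIdeal ?_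
    rintro _ ⟨c, rfl⟩
    rw [mul_comm]
    exact M.1.2.mul_mem c (htC M hM)
  have ht1 : {y | t ∣ y} ≠ ({0} : Set R) := ne_singleton_zero (x := t) dvd_rfl ht0
  refine ⟨⟨I, hIr⟩, ne_singleton_zero (hmem.2 htC) ht0, fun N => ?_⟩
  have hNp := StarMax.isPrimeIdeal hfin N
  by_cases hN : N ∈ C
  · have h1 : f.toFun N = 1 := le_antisymm (hf N) hN
    rw [h1]
    apply le_antisymm
    · obtain ⟨u, hu, hup⟩ := hD.exists_mul_mem_rad hfin hNp (isRIdeal_dvd s t) ht1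
        (unif_spec hD hfin N).1
      have hu0 : u ≠ 0 := fun h => hu (h ▸ zero_mem N.1.2)
      have hp0 := (unif_spec hD hfin N).2.1
      refine (wt_le hD hfin (x := u * unif hD hfin N) (hmem.2 fun M hM => hradC M hM hup)
        (mul_ne_zero hu0 hp0)).trans ?_
      rw [ord_mul hD hfin N hu0 hp0, ord_eq_zero hD hfin N hu, ord_unif]
    · obtain ⟨x, hx, hx0, hxw⟩ := exists_ord_eq_wt hD hfin (I := ⟨I, hIr⟩)
        (ne_singleton_zero (hmem.2 htC) ht0) N
      rw [← hxw]
      exact ord_pos hD hfin N hx0 (hmem.1 hx N hN)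
  · have h1 : f.toFun N = 0 := by
      have h2 : ¬ 1 ≤ f.toFun N := hN
      omega
    obtain ⟨E, hE, hEN, hEC⟩ := exists_finite_of_isOpen hfin hCcl.isOpen_compl hN
    obtain ⟨u, hu, huE⟩ := hNp.exists_common
      (hfin.isRadicalIdeal_rad (isRIdeal_dvd s t)).1 hE fun e he =>
        hD.exists_mul_mem_rad hfin hNp (isRIdeal_dvd s t) ht1 (hEN he)
    -- If u were outside some M ∈ C, then uE ⊆ M would put E into M, while E was chosen so that no
    -- point of `C` contains it.
    have huI : u ∈ I := hmem.2 fun M hM => by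
      by_contra huM
      refine hEC M (fun e he => ?_) hM
      exact ((StarMax.isPrimeIdeal hfin M).2.2 _ _ (hradC M hM (huE e he))).resolve_left huM
    rw [h1, ← Nat.le_zero, ← ord_eq_zero hD hfin N hu]
    exact wt_le hD hfin (I := ⟨I, hIr⟩) huI fun h => hu (h ▸ zero_mem N.1.2)

theorem wt_one (M : s.StarMax) : wt hD hfin 1 M = 0 := by
  have h1 := wt_le hD hfin (M := M) (I := 1) (x := 1) (by rw [RIdeal.val_one]; trivial) one_ne_zero
  rw [ord_eq_zero hD hfin M (StarMax.isPrimeIdeal hfin M).one_notMem] at h1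
  omega

theorem exists_wt_eq (f : CompactUSC s.StarMax) :
    ∃ I : s.StarIdeal, I.1 ≠ {0} ∧ ∀ M, wt hD hfin I M = f.toFun M := by
  induction f using CompactUSC.induction with
  | zero f hf =>
    refine ⟨1, ?_, fun M => by rw [hf, wt_one]⟩
    exact ne_singleton_zero (x := 1) (by rw [RIdeal.val_one]; trivial) one_ne_zero
  | step f ih =>
    obtain ⟨J, hJ, hJw⟩ := ih
    obtain ⟨K, hK, hKw⟩ := exists_wt_eq_of_le_one hD hfin f.trunc fun M => min_le_right _ _
    refine ⟨K * J, mul_ne_singleton_zero hK hJ, fun M => ?_⟩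
    rw [wt_mul hD hfin hK hJ, hKw, hJw, ← CompactUSC.add_apply, f.trunc_add_pred]

end Valuations

/-! ### The lattice isomorphism -/

theorem PrimesMaximalWithRadical.exists_orderIso (h3 : s.PrimesMaximalWithRadical)
    (hfin : s.Finitary) :
    ∃ e : s.StarIdeal ≃o UB s.StarMax, ∀ I J : s.StarIdeal, e (I * J) = e I + e J := by
  classical
  have hD := h3.locallyDVR hfin
  -- The zero ideal needs its own value, because its `wt` is an infimum over the empty set, which is
  -- 0.
  let φ : s.StarIdeal → UB s.StarMax := fun I =>
    if hI : I.1 ≠ {0} then ((wtUSC hD hfin h3 I hI : CompactUSC s.StarMax) : UB s.StarMax) else ⊥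
  have hφ : ∀ {I : s.StarIdeal} (hI : I.1 ≠ {0}), φ I = (wtUSC hD hfin h3 I hI : UB s.StarMax) :=
    fun hI => dif_pos hI
  have hφ0 : ∀ {I : s.StarIdeal}, I.1 = {0} → φ I = ⊥ := fun hI => dif_neg (not_not.2 hI)
  have hle : ∀ I J, φ I ≤ φ J ↔ I ≤ J := by
    intro I J
    by_cases hI : I.1 = {0}
    · rw [hφ0 hI]
      refine ⟨fun _ => ?_, fun _ => bot_le⟩
      rw [RIdeal.le_iff, hI]
      simpa using zero_mem J.2
    by_cases hJ : J.1 = {0}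
    · rw [hφ hI, hφ0 hJ]
      refine ⟨fun h => (WithBot.not_coe_le_bot _ h).elim, fun h => ?_⟩
      rw [RIdeal.le_iff, hJ] at h
      exact (hI (Set.Subset.antisymm h (by simpa using zero_mem I.2))).elim
    · rw [hφ hI, hφ hJ, WithBot.coe_le_coe, le_iff_wt_le hD hfin hI hJ]
      rfl
  have hsurj : Function.Surjective (OrderEmbedding.ofMapLEIff φ hle) := by
    intro f
    induction f using WithBot.recBotCoe with
    | bot => exact ⟨⟨{0}, isRIdeal_zero s⟩, hφ0 rfl⟩
    | coe f =>
      obtain ⟨I, hI, hIw⟩ := exists_wt_eq hD hfin f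
      refine ⟨I, (hφ hI).trans ?_⟩
      exact congrArg _ (CompactUSC.ext (funext hIw))
  refine ⟨RelIso.ofSurjective (OrderEmbedding.ofMapLEIff φ hle) hsurj, fun I J => ?_⟩
  change φ (I * J) = φ I + φ J
  by_cases hI : I.1 = {0}
  · have h1 : (I * J).1 = {0} := Set.Subset.antisymm
      (hI ▸ RIdeal.mul_le_left I J) (by simpa using zero_mem (I * J).2)
    rw [hφ0 hI, hφ0 h1, WithBot.bot_add]
  by_cases hJ : J.1 = {0}
  · have h1 : (I * J).1 = {0} := Set.Subset.antisymm
      (hJ ▸ RIdeal.mul_le_right I J) (by simpa using zero_mem (I * J).2)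
    rw [hφ0 hJ, hφ0 h1, WithBot.add_bot]
  · rw [hφ hI, hφ hJ, hφ (mul_ne_singleton_zero hI hJ), ← WithBot.coe_add]
    exact congrArg _ (CompactUSC.ext (funext (wt_mul hD hfin hI hJ)))

/-- The zero star ideal. -/
def zeroIdeal (s : StarOperation R) : s.StarIdeal := ⟨{0}, isRIdeal_zero s⟩

/-! ### Factorizations read off from the isomorphism -/

section Isomorphism

variable {e : s.StarIdeal ≃o UB s.StarMax}

theorem orderIso_eq_bot_iff {I : s.StarIdeal} : e I = ⊥ ↔ I.1 = {0} := by
  have h0 : e (zeroIdeal s) = ⊥ := by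
    rw [← le_bot_iff, ← e.apply_symm_apply ⊥, e.le_iff_le]
    change ({0} : Set R) ⊆ (e.symm ⊥).1
    simpa using zero_mem (e.symm ⊥).2
  rw [← h0, e.injective.eq_iff]
  exact ⟨fun h => by rw [h]; rfl, fun h => RIdeal.ext' h⟩

theorem exists_orderIso_eq_coe {I : s.StarIdeal} (hI : I.1 ≠ {0}) :
    ∃ f : CompactUSC s.StarMax, e I = f := by
  obtain ⟨f, hf⟩ := WithBot.ne_bot_iff_exists.1 (fun h => hI ((orderIso_eq_bot_iff (e := e)).1 h))
  exact ⟨f, hf.symm⟩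

theorem orderIso_one : e 1 = (CompactUSC.zero' s.StarMax : UB s.StarMax) := by
  apply le_antisymm
  · obtain ⟨f, hf⟩ := exists_orderIso_eq_coe (e := e) (I := (1 : s.StarIdeal))
      (ne_singleton_zero (x := 1) (by rw [RIdeal.val_one]; trivial) one_ne_zero)
    rw [hf, WithBot.coe_le_coe]
    exact fun x => Nat.zero_le _
  · rw [← e.apply_symm_apply (CompactUSC.zero' s.StarMax : UB s.StarMax), e.le_iff_le]
    exact RIdeal.le_one _

theorem eq_one_of_orderIso {I : s.StarIdeal} {f : CompactUSC s.StarMax} (h : e I = f)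
    (hf : ∀ x, f.toFun x = 0) : I = 1 := by
  apply e.injective
  rw [h, orderIso_one]
  exact congrArg _ (CompactUSC.ext (funext hf))

theorem apply_eq_zero_of_orderIso_one {f : CompactUSC s.StarMax}
    (h : e 1 = f) (x : s.StarMax) : f.toFun x = 0 := by
  rw [orderIso_one, WithBot.coe_inj] at h
  rw [← h]
  rfl

theorem orderIso_pow
    (he : ∀ I J : s.StarIdeal, e (I * J) = e I + e J)
    {I : s.StarIdeal} {f : CompactUSC s.StarMax} (h : e I = f) (n : ℕ) :
    ∃ g : CompactUSC s.StarMax, e (I ^ n) = g ∧ ∀ x, g.toFun x = n * f.toFun x := by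
  induction n with
  | zero => exact ⟨_, by rw [pow_zero]; exact orderIso_one, fun x => (Nat.zero_mul _).symm⟩
  | succ n ih =>
    obtain ⟨g, hg, hgx⟩ := ih
    refine ⟨g + f, by rw [pow_succ, he, hg, h]; rfl, fun x => ?_⟩
    rw [CompactUSC.add_apply, hgx, Nat.succ_mul]

/-- If g ≤ n, then (n + 1)·min(g, 1) ≥ g, so a power of the ideal of min(g, 1) lies in `J`, and
radicality gives g ≤ min(g, 1). Conversely, n·f ≥ g with g ≤ 1 forces f ≥ g. -/
theorem isRadicalIdeal_iff_of_orderIso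
    (he : ∀ I J : s.StarIdeal, e (I * J) = e I + e J)
    {J : s.StarIdeal} {g : CompactUSC s.StarMax}
    (h : e J = g) : s.IsRadicalIdeal J.1 ↔ ∀ x, g.toFun x ≤ 1 := by
  constructor
  · intro hJ
    obtain ⟨n, hn⟩ := g.exists_bound
    have hK : e (e.symm g.trunc) = g.trunc := e.apply_symm_apply _
    obtain ⟨f, hf, hfx⟩ := orderIso_pow he hK (n + 1)
    have h1 : e.symm g.trunc ^ (n + 1) ≤ J := by
      rw [← e.le_iff_le, hf, h, WithBot.coe_le_coe]
      intro x
      rw [hfx, CompactUSC.trunc_apply]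
      have h2 := hn x
      rcases Nat.eq_zero_or_pos (g.toFun x) with h0 | h0
      · omega
      · rw [min_eq_right h0]
        omega
    have h2 : e.symm g.trunc ≤ J := fun x hx =>
      hJ.2 (n + 1) x (by omega) (h1 (RIdeal.pow_mem_pow hx (n + 1)))
    rw [← e.le_iff_le, hK, h, WithBot.coe_le_coe] at h2
    exact fun x => (h2 x).trans (min_le_right _ _)
  · intro hg
    refine ⟨J.2, fun n x hn hx => ?_⟩
    have hpow : ∀ n, s.toRIdeal {x} ^ n = s.toRIdeal {x ^ n} := by
      intro n
      induction n with
      | zero => rw [pow_zero, pow_zero]; rfl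
      | succ n ih =>
        rw [pow_succ, ih, pow_succ]
        apply RIdeal.ext'
        change s.cl (s.cl _ * s.cl _) = s.cl _
        rw [cl_mul_cl, Set.singleton_mul_singleton]
    have h1 : s.toRIdeal {x} ^ n ≤ J := by
      rw [hpow]
      exact J.2.cl_subset (by simpa using hx)
    by_cases hx0 : x = 0
    · rw [hx0]
      exact zero_mem J.2
    obtain ⟨f, hf⟩ := exists_orderIso_eq_coe (e := e) (I := s.toRIdeal {x})
      (ne_singleton_zero (subset_cl _ rfl) hx0)
    obtain ⟨f', hf', hfx⟩ := orderIso_pow he hf n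
    rw [← e.le_iff_le, hf', h, WithBot.coe_le_coe] at h1
    have h2 : s.toRIdeal {x} ≤ J := by
      rw [← e.le_iff_le, hf, h, WithBot.coe_le_coe]
      intro y
      have h3 := h1 y
      rw [hfx] at h3
      rcases Nat.eq_zero_or_pos (f.toFun y) with h0 | h0
      · rw [h0, mul_zero] at h3
        omega
      · exact (hg y).trans h0
    exact h2 (subset_cl _ rfl)

theorem exists_isChainProdRadical_of_orderIso
    (he : ∀ I J : s.StarIdeal, e (I * J) = e I + e J)
    (f : CompactUSC s.StarMax) (I : s.StarIdeal)
    (hI : e I = f) :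
    ∃ L : List s.StarIdeal, (∀ J ∈ L, J.1 ≠ Set.univ) ∧ s.IsChainProdRadical I L := by
  induction f using CompactUSC.induction generalizing I with
  | zero f hf =>
    exact ⟨[], by simp, by simp, by simp, (eq_one_of_orderIso hI hf).symm⟩
  | step f ih =>
    by_cases hf : ∀ x, f.toFun x = 0
    · exact ⟨[], by simp, by simp, by simp, (eq_one_of_orderIso hI hf).symm⟩
    obtain ⟨L, hL1, hLr, hLc, hLp⟩ := ih (e.symm f.pred) (e.apply_symm_apply _)
    have hJ : e (e.symm f.trunc) = f.trunc := e.apply_symm_apply _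
    refine ⟨e.symm f.trunc :: L, ?_, ?_, ?_, ?_⟩
    · rintro J hJL
      rcases List.mem_cons.1 hJL with rfl | hJL
      · rw [Ne, ← RIdeal.eq_one_iff]
        intro h1
        rw [h1] at hJ
        apply hf
        intro x
        have h2 := apply_eq_zero_of_orderIso_one hJ x
        rw [CompactUSC.trunc_apply] at h2
        omega
      · exact hL1 J hJL
    · rintro J hJL
      rcases List.mem_cons.1 hJL with rfl | hJL
      · exact (isRadicalIdeal_iff_of_orderIso he hJ).2 fun x => min_le_right _ _
      · exact hLr J hJL
    · refine List.pairwise_cons.2 ⟨fun K hK => ?_, hLc⟩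
      -- A later factor has a function bounded by both f - 1 and 1, hence by min(f, 1), so it
      -- contains the new first factor.
      have h1 : e.symm f.pred ≤ K := hLp ▸ RIdeal.prod_le_of_mem hK
      rw [← e.le_iff_le, e.apply_symm_apply] at h1
      have hK0 : e K ≠ ⊥ := fun h => WithBot.not_coe_le_bot _ (h ▸ h1)
      obtain ⟨g, hg⟩ := WithBot.ne_bot_iff_exists.1 hK0
      rw [← hg, WithBot.coe_le_coe] at h1
      rw [← e.le_iff_le, hJ, ← hg, WithBot.coe_le_coe]
      intro x
      have h2 := h1 x
      have h3 := (isRadicalIdeal_iff_of_orderIso he hg.symm).1 (hLr K hK) x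
      rw [CompactUSC.pred_apply] at h2
      rw [CompactUSC.trunc_apply]
      omega
    · apply e.injective
      rw [List.prod_cons, he, hLp, hJ, e.apply_symm_apply, hI, ← WithBot.coe_add, f.trunc_add_pred]

theorem mul_left_cancel_of_orderIso
    (he : ∀ I J : s.StarIdeal, e (I * J) = e I + e J)
    {J A B : s.StarIdeal} (hJ : J.1 ≠ {0}) (h : J * A = J * B) :
    A = B := by
  obtain ⟨g, hg⟩ := exists_orderIso_eq_coe (e := e) hJ
  have h1 := congrArg e h
  rw [he, he, hg] at h1
  apply e.injective
  generalize e A = a at h1 ⊢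
  generalize e B = b at h1 ⊢
  induction a using WithBot.recBotCoe with
  | bot =>
    induction b using WithBot.recBotCoe with
    | bot => rfl
    | coe b => rw [WithBot.add_bot, ← WithBot.coe_add] at h1; exact (WithBot.bot_ne_coe h1).elim
  | coe a =>
    induction b using WithBot.recBotCoe with
    | bot => rw [WithBot.add_bot, ← WithBot.coe_add] at h1; exact (WithBot.coe_ne_bot h1).elim
    | coe b =>
      rw [← WithBot.coe_add, ← WithBot.coe_add, WithBot.coe_inj] at h1
      refine congrArg _ (CompactUSC.ext (funext fun x => ?_))
      have h2 := congrArg (fun f => f.toFun x) h1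
      exact Nat.add_left_cancel h2

theorem pow_length_mem_prod {x : R} {L : List s.StarIdeal} (h : ∀ J ∈ L, x ∈ J.1) :
    x ^ L.length ∈ L.prod.1 := by
  induction L with
  | nil => simp [RIdeal.val_one]
  | cons J L ih =>
    rw [List.prod_cons, List.length_cons, pow_succ']
    exact RIdeal.mul_mem_mul (h J List.mem_cons_self) (ih fun K hK => h K (List.mem_cons_of_mem _ hK))

/-- An element of the least factor lies in every factor, so its power with exponent the number of
factors lies in the product. -/
theorem IsChainProdRadical.head_eq_rad {I J : s.StarIdeal} {L : List s.StarIdeal}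
    (h : s.IsChainProdRadical I (J :: L)) : J.1 = rad I.1 := by
  obtain ⟨hr, hc, hp⟩ := h
  apply Set.Subset.antisymm
  · intro x hx
    refine ⟨(J :: L).length, by simp, ?_⟩
    rw [← hp]
    apply pow_length_mem_prod
    intro K hK
    rcases List.mem_cons.1 hK with rfl | hK
    · exact hx
    · exact (List.pairwise_cons.1 hc).1 K hK hx
  · refine rad_subset_of_subset (hr J List.mem_cons_self) ?_
    rw [← hp]
    exact RIdeal.prod_le_of_mem List.mem_cons_self

/-- The first factor is forced to be the radical of `I`; being nonzero it cancels, since addition of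
functions is cancellative. -/
theorem IsChainProdRadical.unique_of_orderIso
    (he : ∀ I J : s.StarIdeal, e (I * J) = e I + e J)
    {L L' : List s.StarIdeal} {I : s.StarIdeal}
    (hI : I.1 ≠ {0}) (h1 : ∀ J ∈ L, J.1 ≠ Set.univ) (h : s.IsChainProdRadical I L)
    (h1' : ∀ J ∈ L', J.1 ≠ Set.univ) (h' : s.IsChainProdRadical I L') : L = L' := by
  have hone : ∀ {J : s.StarIdeal} {T : List s.StarIdeal}, s.IsChainProdRadical 1 (J :: T) →
      J.1 = Set.univ := by
    intro J T hT
    rw [← RIdeal.eq_one_iff]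
    refine le_antisymm (RIdeal.le_one J) ?_
    rw [← hT.2.2]
    exact RIdeal.prod_le_of_mem List.mem_cons_self
  induction L generalizing L' I with
  | nil =>
    cases L' with
    | nil => rfl
    | cons J T =>
      have hI1 : I = 1 := h.2.2.symm
      subst hI1
      exact (h1' J List.mem_cons_self (hone h')).elim
  | cons J T ih =>
    cases L' with
    | nil =>
      have hI1 : I = 1 := h'.2.2.symm
      subst hI1
      exact (h1 J List.mem_cons_self (hone h)).elim
    | cons J' T' =>
      obtain rfl : J = J' := RIdeal.ext' (h.head_eq_rad.trans h'.head_eq_rad.symm)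
      have hp : J * T.prod = I := by rw [← List.prod_cons]; exact h.2.2
      have hp' : J * T'.prod = I := by rw [← List.prod_cons]; exact h'.2.2
      have hzero : ∀ {K : s.StarIdeal}, I ≤ K → K.1 ≠ {0} := by
        intro K hIK hK
        obtain ⟨x, hx, hx0⟩ := exists_ne_zero I.2 hI
        have h2 := hIK hx
        rw [hK] at h2
        exact hx0 h2
      have hJ0 := hzero (hp ▸ RIdeal.mul_le_left J T.prod)
      have hT0 := hzero (hp ▸ RIdeal.mul_le_right J T.prod)
      have hTT := mul_left_cancel_of_orderIso he hJ0 (hp.trans hp'.symm)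
      rw [ih hT0 (fun K hK => h1 K (List.mem_cons_of_mem _ hK))
        ⟨fun K hK => h.1 K (List.mem_cons_of_mem _ hK), (List.pairwise_cons.1 h.2.1).2, rfl⟩
        (fun K hK => h1' K (List.mem_cons_of_mem _ hK))
        ⟨fun K hK => h'.1 K (List.mem_cons_of_mem _ hK), (List.pairwise_cons.1 h'.2.1).2, hTT.symm⟩]

end Isomorphism

end StarOperation

/-! ### The equivalences -/

open StarOperation

theorem corollary8p6 {R : Type*} [CommRing R] [IsDomain R] (s : StarOperation R)
    (hfin : s.Finitary) (hmod : s.Modular) :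
    List.TFAE [
      -- (1)
      s.IsSPDomain,
      -- (2)
      s.dim ≤ 1 ∧ ∀ I : s.StarIdeal, s.IsInvertible I.1 → s.IsProdRadical I,
      -- (3)
      ∀ P : Set R, s.IsPrimeIdeal P → P ≠ {0} →
        s.IsMaximalIdeal P ∧ ∃ J : Set R, J ⊆ P ∧ s.IsInvertible J ∧ s.IsRadicalIdeal J,
      -- (4), existence for every star ideal
      ∀ I : s.StarIdeal, ∃ L : List s.StarIdeal, s.IsChainProdRadical I L,
      -- (4), existence and uniqueness with proper factors for every nonzero star ideal
      ∀ I : s.StarIdeal, I.1 ≠ {0} →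
        ∃! L : List s.StarIdeal, (∀ J ∈ L, J.1 ≠ Set.univ) ∧ s.IsChainProdRadical I L,
      -- (5)
      ∀ I : Set R, s.IsFG I → I ≠ {0} → s.IsInvertible (WeakIdealSystem.rad I),
      -- (6)
      ∃ e : s.StarIdeal ≃o UB s.StarMax, ∀ I J : s.StarIdeal, e (I * J) = e I + e J,
      -- (7)
      s.IsPMD ∧ ∀ I : Set R, s.IsFG I → s.IsFG (WeakIdealSystem.rad I)] := by
  have hrad_zero : rad ({0} : Set R) = {0} := rad_eq_self (isPrimeIdeal_zero s).isRadicalIdeal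
  have rad_ne_zero : ∀ {I : Set R}, s.IsFG I → I ≠ {0} → rad I ≠ {0} := by
    intro I hI hI0
    obtain ⟨x, hx, hx0⟩ := exists_ne_zero hI.1 hI0
    exact ne_singleton_zero (subset_rad I hx) hx0
  tfae_have 1 → 2 := fun h =>
    ⟨(h.primesMaximalWithRadical hfin hmod).dim_le_one, fun I _ => h I⟩
  tfae_have 2 → 3 := fun h => primesMaximalWithRadical_of_dim_le_one hfin h.1 h.2
  tfae_have 3 → 8 := by
    intro h3
    have h3' : s.PrimesMaximalWithRadical := h3
    refine ⟨(h3'.locallyDVR hfin).isPMD hfin, fun I hI => ?_⟩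
    -- The zero ideal is its own radical, so its finite generation is immediate; the local argument
    -- needs a nonzero ideal.
    by_cases hI0 : I = {0}
    · rw [hI0, hrad_zero, ← hI0]
      exact hI
    · exact h3'.isFG_rad hfin hI hI0
  tfae_have 8 → 6 := fun h I hI hI0 => h.1 _ (h.2 I hI) (rad_ne_zero hI hI0)
  tfae_have 6 → 3 := fun h => primesMaximalWithRadical_of_isInvertible_rad hfin h
  tfae_have 3 → 7 := fun h =>
    PrimesMaximalWithRadical.exists_orderIso h hfin
  tfae_have 7 → 5 := by
    rintro ⟨e, he⟩ I hI
    obtain ⟨f, hf⟩ := exists_orderIso_eq_coe (e := e) hI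
    obtain ⟨L, hL1, hL⟩ := exists_isChainProdRadical_of_orderIso he f I hf
    exact ⟨L, ⟨hL1, hL⟩, fun L' hL' => hL'.2.unique_of_orderIso he hI hL'.1 hL1 hL⟩
  tfae_have 5 → 4 := by
    intro h I
    by_cases hI : I.1 = {0}
    · refine ⟨[I], ?_, by simp, by simp⟩
      intro J hJ
      rw [List.mem_singleton.1 hJ, hI]
      exact (isPrimeIdeal_zero s).isRadicalIdeal
    · obtain ⟨L, hL, -⟩ := h I hI
      exact ⟨L, hL.2⟩
  tfae_have 4 → 1 := by
    intro h I
    obtain ⟨L, hL⟩ := h I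
    exact ⟨L, hL.1, hL.2.2⟩
  tfae_finish
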